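/- Let $A$ and $B$ be real symmetric $n\times n$ matrices and put $H_t=A+tB$ for $t\in\mathbb R$. By an analytic eigenbasis of $(A,B)$ we mean functions $\lambda_{1,t},\dots,\lambda_{n,t}\in\mathbb R$ and $\varphi_{1,t},\dots,\varphi_{n,t}\in\mathbb R^n$, real analytic in $t\in\mathbb R$, such that for every $t$ the vectors $\varphi_{1,t},\dots,\varphi_{n,t}$ are an orthonormal basis of $\mathbb R^n$ and $H_t\varphi_{k,t}=\lambda_{k,t}\varphi_{k,t}$ for all $k$. (1) There is an analytic eigenbasis of $(A,B)$ such that for all $k\ne k'$ and all $i$ in $\{1,\dots,n\}$: if $\lambda_{k,t}-\lambda_{k',t}\neq0$ for some $t\in\mathbb R$, then this holds for all but finitely many $t\in\mathbb R$; and if $\varphi_{k,t}(i)\ne0$ for some $t\in\mathbb R$, then this holds for all but finitely many $t\in\mathbb R$. (2) For every analytic eigenbasis of $(A,B)$, the statement of (1) about $\lambda_{k,t}-\lambda_{k',t}$ holds for all $k\neq k'$, and the statement of (1) about $\varphi_{k,t}(i)$ holds for all $i$ and all those $k$ for which no $\lambda_{k',t}$ with $k'\ne k$ is equal to $\lambda_{k,t}$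 for all $t\in\mathbb R$. (3) Say that a real symmetric matrix has simple eigenvalues if all its eigenspaces are one-dimensional, and non-vanishing eigenvectors if all entries of all its eigenvectors are nonzero. Call $(A,B)$ good if $H_t$ has both properties for all but finitely many $t\in\mathbb R$, and bad if for every $t\in\mathbb R$ it fails to have at least one of them. Then $(A,B)$ is either good or bad, and not both. (4) Let $G$ be a finite simple graph with Laplacian $(\Delta\psi)(x)=\sum_{y\sim x}(\psi(x)-\psi(y))$, and let $V$ be a potential, that is, a real diagonal matrix indexed by the vertices of $G$. Call $V$ good (bad) if the pair $(\Delta,V)$ is good (bad). Then $V$ is either good or bad, and not both. -/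

import Mathlib

namespace AndersonSpectral

/-- The one-parameter family `H_t(A,B) = A + tB`. -/
def pencil {ι : Type*} (A B : Matrix ι ι ℝ) (t : ℝ) : Matrix ι ι ℝ := A + t • B

/-- `M` has simple eigenvalues: the eigenspace of each eigenvalue is one-dimensional
(for symmetric `M` this agrees with algebraic multiplicity one). -/
def HasSimpleEigenvalues {ι : Type*} [Fintype ι] [DecidableEq ι] (M : Matrix ι ι ℝ) : Prop :=
  ∀ r : ℝ, Module.End.HasEigenvalue (Matrix.toLin' M) r →
    Module.finrank ℝ (Module.End.eigenspace (Matrix.toLin' M) r) = 1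

/-- `M` has non-vanishing eigenvectors: all entries of all eigenvectors are nonzero. -/
def HasNonvanishingEigenvectors {ι : Type*} [Fintype ι] [DecidableEq ι]
    (M : Matrix ι ι ℝ) : Prop :=
  ∀ (r : ℝ) (v : ι → ℝ), Module.End.HasEigenvector (Matrix.toLin' M) r v → ∀ i, v i ≠ 0

/-- `(A, B)` is a good pair: for all but finitely many `t`, the matrix `A + tB` has simple
eigenvalues and non-vanishing eigenvectors. -/
def IsGoodPair {ι : Type*} [Fintype ι] [DecidableEq ι] (A B : Matrix ι ι ℝ) : Prop :=
  {t : ℝ | ¬ (HasSimpleEigenvalues (pencil A B t) ∧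
    HasNonvanishingEigenvectors (pencil A B t))}.Finite

/-- `(A, B)` is a bad pair: for every real `t`, the matrix `A + tB` fails at least one of the
two conditions. -/
def IsBadPair {ι : Type*} [Fintype ι] [DecidableEq ι] (A B : Matrix ι ι ℝ) : Prop :=
  ∀ t : ℝ, ¬ HasSimpleEigenvalues (pencil A B t) ∨
    ¬ HasNonvanishingEigenvectors (pencil A B t)

/-- The potential `diag(w)` on a finite graph `G` is good: `H_t = Δ + t diag(w)`, with
`(Δψ)(x) = ∑_{y ∼ x} (ψ(x) - ψ(y))` the graph Laplacian, satisfies both conditions for all but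
finitely many `t`. -/
def IsGoodPotential {V : Type*} [Fintype V] [DecidableEq V] (G : SimpleGraph V)
    [DecidableRel G.Adj] (w : V → ℝ) : Prop :=
  IsGoodPair (G.lapMatrix ℝ) (Matrix.diagonal w)

/-- The potential `diag(w)` on a finite graph `G` is bad: `H_t = Δ + t diag(w)` fails at least
one of the two conditions for every `t`. -/
def IsBadPotential {V : Type*} [Fintype V] [DecidableEq V] (G : SimpleGraph V)
    [DecidableRel G.Adj] (w : V → ℝ) : Prop :=
  IsBadPair (G.lapMatrix ℝ) (Matrix.diagonal w)

/-- `lam k`, `phi k` (for `k : Fin n`) are families of eigenvalues and eigenvectors of `A + tB`,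
real analytic in `t` on the whole real line, such that `phi k t`, `k : Fin n`, is an orthonormal
basis of Euclidean `ℝⁿ` for every `t` (`n` orthonormal vectors in dimension `n`). -/
structure IsAnalyticEigenbasis {n : ℕ} (A B : Matrix (Fin n) (Fin n) ℝ)
    (lam : Fin n → ℝ → ℝ) (phi : Fin n → ℝ → EuclideanSpace ℝ (Fin n)) : Prop where
  analytic_lam : ∀ k, AnalyticOnNhd ℝ (lam k) Set.univ
  analytic_phi : ∀ k, AnalyticOnNhd ℝ (phi k) Set.univ
  orthonormal : ∀ t, Orthonormal ℝ (fun k => phi k t)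
  eigen : ∀ k t, Matrix.toEuclideanLin (pencil A B t) (phi k t) = lam k t • phi k t

end AndersonSpectral

/-! The eigenbasis can be chosen from Nash functions: real analytic functions on the line that are
algebraic over the polynomials in `t`. A nonzero Nash function divides a nonzero polynomial, so it
has finitely many zeros (`Nash.finite_zeros`), and every finiteness claim comes from this.

Eigenvalues: the characteristic polynomial of `A + tB` is real-rooted with coefficients polynomial
in `t`. Locally its roots are analytic, by induction on the degree. Distinct roots at the base point
are separated by Hensel's lemma. If all roots of a centred family coalesce, their sum of squares is
a nonnegative analytic function vanishing there, hence `O(t²)`; the roots can then be divided by `t`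
(`exists_blowup`). Analytic continuation along the line makes the roots global
(`exists_analyticOnNhd_roots`).

Eigenvectors: over the domain `Nash`, Cayley–Hamilton gives an eigenvector in the orthogonal
complement of those already found. Dividing out common zeros makes it nowhere vanishing, and then
its norm has a Nash inverse (`Nash.exists_orthonormal_eigenvectors`).

The pair is good when the Nash eigenvalues are distinct functions and no entry is the zero function;
otherwise one failure persists for all `t`. An arbitrary analytic eigenbasis is compared with the
Nash one by inner products (`IsAnalyticEigenbasis.exists_eq`). Simplicity is needed there for
entries, since vectors sharing an eigenvalue may be rotated by a non-algebraic analytic angle. -/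

open Polynomial Filter Topology

namespace AndersonSpectral

/-! ### Hensel's lemma for analytic families of polynomials -/

/-- The polynomial of degree less than `m` with the given coefficients. -/
noncomputable def polyOfCoeffs (m : ℕ) : (Fin m → ℝ) →ₗ[ℝ] ℝ[X] :=
  (degreeLT ℝ m).subtype ∘ₗ (degreeLTEquiv ℝ m).symm.toLinearMap

/-- The coefficients of a polynomial below degree `N`. -/
noncomputable def lowCoeffs (N : ℕ) : ℝ[X] →ₗ[ℝ] (Fin N → ℝ) :=
  LinearMap.pi fun i => lcoeff ℝ i

lemma polyOfCoeffs_mem (m : ℕ) (u : Fin m → ℝ) : polyOfCoeffs m u ∈ degreeLT ℝ m :=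
  ((degreeLTEquiv ℝ m).symm u).2

lemma degree_polyOfCoeffs_lt (m : ℕ) (u : Fin m → ℝ) : (polyOfCoeffs m u).degree < m :=
  mem_degreeLT.1 (polyOfCoeffs_mem m u)

lemma polyOfCoeffs_injective (m : ℕ) : Function.Injective (polyOfCoeffs m) :=
  Subtype.val_injective.comp (degreeLTEquiv ℝ m).symm.injective

lemma eq_of_lowCoeffs_eq {N : ℕ} {p q : ℝ[X]} (hp : p.Monic) (hq : q.Monic)
    (hpN : p.natDegree = N) (hqN : q.natDegree = N) (h : lowCoeffs N p = lowCoeffs N q) :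
    p = q := by
  ext i
  rcases lt_trichotomy i N with hi | rfl | hi
  · exact congrFun h ⟨i, hi⟩
  · rw [← hpN, hp.coeff_natDegree, hpN, ← hqN, hq.coeff_natDegree]
  · rw [coeff_eq_zero_of_natDegree_lt (by lia), coeff_eq_zero_of_natDegree_lt (by lia)]

lemma eq_zero_of_lowCoeffs_eq_zero {N : ℕ} {p : ℝ[X]} (hp : p.degree < N)
    (h : lowCoeffs N p = 0) : p = 0 := by
  ext i
  rcases lt_or_ge i N with hi | hi
  · exact congrFun h ⟨i, hi⟩
  · exact coeff_eq_zero_of_degree_lt (hp.trans_le (by exact_mod_cast hi))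

section Factorization

variable {m k : ℕ}

/-- The linearization of polynomial multiplication at `(q₀, r₀)`. -/
noncomputable def factorLinear (m k : ℕ) (q₀ r₀ : ℝ[X]) :
    ((Fin m → ℝ) × (Fin k → ℝ)) →ₗ[ℝ] (Fin (m + k) → ℝ) :=
  lowCoeffs (m + k) ∘ₗ
    ((LinearMap.mulLeft ℝ r₀ ∘ₗ polyOfCoeffs m).coprod (LinearMap.mulLeft ℝ q₀ ∘ₗ polyOfCoeffs k))

/-- Multiplication of polynomials of low degree, in coefficients. -/
noncomputable def mulCoeffs (m k : ℕ) :
    (Fin m → ℝ) →ₗ[ℝ] (Fin k → ℝ) →ₗ[ℝ] (Fin (m + k) → ℝ) :=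
  ((LinearMap.mul ℝ ℝ[X]).compl₁₂ (polyOfCoeffs m) (polyOfCoeffs k)).compr₂ (lowCoeffs (m + k))

/-- Invertibility of the Sylvester matrix: if `r₀ u + q₀ v = 0`, coprimality gives `q₀ ∣ u`, and `u`
has smaller degree than `q₀`. -/
lemma factorLinear_injective {q₀ r₀ : ℝ[X]} (hq : q₀.Monic) (hr : r₀.Monic)
    (hqm : q₀.natDegree = m) (hrk : r₀.natDegree = k) (hco : IsCoprime q₀ r₀) :
    Function.Injective (factorLinear m k q₀ r₀) := by
  rw [← LinearMap.ker_eq_bot, LinearMap.ker_eq_bot']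
  rintro ⟨u, v⟩ h
  have hu := degree_polyOfCoeffs_lt m u
  have hv := degree_polyOfCoeffs_lt k v
  have hqd : q₀.degree = m := by rw [degree_eq_natDegree hq.ne_zero, hqm]
  have hrd : r₀.degree = k := by rw [degree_eq_natDegree hr.ne_zero, hrk]
  have h0 : r₀ * polyOfCoeffs m u + q₀ * polyOfCoeffs k v = 0 := by
    refine eq_zero_of_lowCoeffs_eq_zero (N := m + k) ?_ (by simpa [factorLinear] using h)
    refine (degree_add_le _ _).trans_lt (max_lt ?_ ?_)
    · rw [degree_mul, hrd, add_comm]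
      push_cast
      exact WithBot.add_lt_add_right (by simp) hu
    · rw [degree_mul, hqd]
      push_cast
      exact WithBot.add_lt_add_left (by simp) hv
  have h1 : polyOfCoeffs m u = 0 := by
    refine eq_zero_of_dvd_of_degree_lt (p := q₀) (hco.dvd_of_dvd_mul_left ?_) (hqd ▸ hu)
    exact ⟨-polyOfCoeffs k v, by linear_combination h0⟩
  have h2 : polyOfCoeffs k v = 0 := by
    rw [h1, mul_zero, zero_add] at h0
    exact (mul_eq_zero.1 h0).resolve_left hq.ne_zero
  rw [Prod.mk_eq_zero]
  exact ⟨polyOfCoeffs_injective m (by simpa using h1), polyOfCoeffs_injective k (by simpa using h2)⟩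

/-- **Hensel's lemma for analytic families**: a factorization into coprime monic polynomials at
one parameter extends analytically to nearby parameters. -/
theorem exists_analytic_factorization {P : ℝ → ℝ[X]} {q₀ r₀ : ℝ[X]} {s : ℝ}
    (hq : q₀.Monic) (hr : r₀.Monic) (hqm : q₀.natDegree = m) (hrk : r₀.natDegree = k)
    (hco : IsCoprime q₀ r₀) (hP : ∀ i, AnalyticAt ℝ (fun t => (P t).coeff i) s)
    (hmonic : ∀ᶠ t in 𝓝 s, (P t).Monic ∧ (P t).natDegree = m + k) (h0 : P s = q₀ * r₀) :
    ∃ q r : ℝ → ℝ[X], (∀ i, AnalyticAt ℝ (fun t => (q t).coeff i) s) ∧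
      (∀ i, AnalyticAt ℝ (fun t => (r t).coeff i) s) ∧
      (∀ t, (q t).Monic ∧ (q t).natDegree = m) ∧ (∀ t, (r t).Monic ∧ (r t).natDegree = k) ∧
      ∀ᶠ t in 𝓝 s, P t = q t * r t := by
  have hqd : q₀.degree = m := by rw [degree_eq_natDegree hq.ne_zero, hqm]
  have hrd : r₀.degree = k := by rw [degree_eq_natDegree hr.ne_zero, hrk]
  let L : ((Fin m → ℝ) × (Fin k → ℝ)) ≃L[ℝ] (Fin (m + k) → ℝ) :=
    (LinearEquiv.ofInjectiveOfFinrankEq (factorLinear m k q₀ r₀)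
      (factorLinear_injective hq hr hqm hrk hco) (by simp)).toContinuousLinearEquiv
  let β : (Fin m → ℝ) →L[ℝ] (Fin k → ℝ) →L[ℝ] (Fin (m + k) → ℝ) :=
    (mulCoeffs m k).toContinuousBilinearMap
  -- `F (u, v)` lists the low coefficients of `(q₀ + u)(r₀ + v) - q₀ r₀`. The term `β` is quadratic,
  -- so the derivative at `0` is `L`, and the inverse function theorem solves for the corrections
  -- `u`, `v`.
  let F : (Fin m → ℝ) × (Fin k → ℝ) → (Fin (m + k) → ℝ) := fun w => L w + β w.1 w.2
  have hF : ContDiff ℝ ⊤ F := by fun_prop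
  have hF' : HasFDerivAt F (L : _ →L[ℝ] _) 0 := by
    have h1 := L.hasFDerivAt (x := 0)
    have h2 := β.isBoundedBilinearMap.hasFDerivAt (0 : (Fin m → ℝ) × (Fin k → ℝ))
    have h3 : (L : ((Fin m → ℝ) × (Fin k → ℝ)) →L[ℝ] (Fin (m + k) → ℝ)) +
        β.isBoundedBilinearMap.deriv 0 = L := by
      ext <;> simp
    exact h3 ▸ h1.add h2
  have hF0 : F 0 = 0 := by simp [F]
  have hs := hF.contDiffAt.hasStrictFDerivAt' hF' (by simp)
  have hinv := hs.eventually_right_inverse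
  have hg := hF.contDiffAt.to_localInverse hF' (by simp)
  set g := hF.contDiffAt.localInverse hF' (by simp) with hgdef
  rw [hF0] at hinv hg
  let y : ℝ → Fin (m + k) → ℝ := fun t => lowCoeffs (m + k) (P t) - lowCoeffs (m + k) (q₀ * r₀)
  have hy : AnalyticAt ℝ y s := by
    refine AnalyticAt.sub ?_ analyticAt_const
    exact analyticAt_pi_iff.2 fun i => hP i
  have hy0 : y s = 0 := by simp [y, h0]
  have hw : AnalyticAt ℝ (fun t => g (y t)) s := by
    refine AnalyticAt.comp ?_ hy
    rw [hy0]
    exact hg.analyticAt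
  have hcoe : ∀ (N : ℕ) (f : ℝ → Fin N → ℝ) (p : ℝ[X]), AnalyticAt ℝ f s →
      ∀ i, AnalyticAt ℝ (fun t => (p + polyOfCoeffs N (f t)).coeff i) s := by
    intro N f p hf i
    simp only [coeff_add]
    refine analyticAt_const.add ?_
    exact ((lcoeff ℝ i ∘ₗ polyOfCoeffs N).toContinuousLinearMap.analyticAt _).comp hf
  have hqt : ∀ t, (q₀ + polyOfCoeffs m (g (y t)).1).Monic ∧
      (q₀ + polyOfCoeffs m (g (y t)).1).natDegree = m := fun t =>
    have hlt := (degree_polyOfCoeffs_lt m (g (y t)).1).trans_eq hqd.symm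
    ⟨hq.add_of_left hlt, by rw [natDegree_add_eq_left_of_degree_lt hlt, hqm]⟩
  have hrt : ∀ t, (r₀ + polyOfCoeffs k (g (y t)).2).Monic ∧
      (r₀ + polyOfCoeffs k (g (y t)).2).natDegree = k := fun t =>
    have hlt := (degree_polyOfCoeffs_lt k (g (y t)).2).trans_eq hrd.symm
    ⟨hr.add_of_left hlt, by rw [natDegree_add_eq_left_of_degree_lt hlt, hrk]⟩
  refine ⟨fun t => q₀ + polyOfCoeffs m (g (y t)).1, fun t => r₀ + polyOfCoeffs k (g (y t)).2,
    hcoe m _ _ (analyticAt_fst.comp hw), hcoe k _ _ (analyticAt_snd.comp hw), hqt, hrt, ?_⟩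
  have hlim : Tendsto y (𝓝 s) (𝓝 0) := hy0 ▸ hy.continuousAt
  filter_upwards [hmonic, hlim.eventually hinv] with t ht hFt
  refine eq_of_lowCoeffs_eq (N := m + k) ht.1 ((hqt t).1.mul (hrt t).1) ht.2 ?_ ?_
  · rw [(hqt t).1.natDegree_mul (hrt t).1, (hqt t).2, (hrt t).2]
  · have h4 : lowCoeffs (m + k) (P t) = lowCoeffs (m + k) (q₀ * r₀) + F (g (y t)) := by
      rw [hgdef]
      exact (sub_eq_iff_eq_add'.1 hFt.symm)
    have h5 : F (g (y t)) = lowCoeffs (m + k) (r₀ * polyOfCoeffs m (g (y t)).1 +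
        q₀ * polyOfCoeffs k (g (y t)).2 +
        polyOfCoeffs m (g (y t)).1 * polyOfCoeffs k (g (y t)).2) := by
      simp only [map_add]
      have h6 : ∀ w : (Fin m → ℝ) × (Fin k → ℝ), L w = lowCoeffs (m + k) (r₀ * polyOfCoeffs m w.1) +
          lowCoeffs (m + k) (q₀ * polyOfCoeffs k w.2) := fun w => map_add (lowCoeffs (m + k)) _ _
      simp [F, h6, β, mulCoeffs]
    rw [h4, h5, ← map_add]
    congr 1
    ring

end Factorization

/-! ### Real-rooted polynomials and their tuples of roots -/

/-- The monic polynomial with prescribed roots. -/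
noncomputable def rootPoly {n : ℕ} (r : Fin n → ℝ) : ℝ[X] := ∏ i, (X - C (r i))

lemma rootPoly_eq_multiset {n : ℕ} (r : Fin n → ℝ) :
    rootPoly r = ((Finset.univ.val.map r).map fun t => X - C t).prod := by
  simp only [rootPoly, Finset.prod, Multiset.map_map, Function.comp_def]

lemma rootPoly_monic {n : ℕ} (r : Fin n → ℝ) : (rootPoly r).Monic :=
  monic_prod_of_monic _ _ fun i _ => monic_X_sub_C (r i)

@[simp] lemma natDegree_rootPoly {n : ℕ} (r : Fin n → ℝ) : (rootPoly r).natDegree = n := by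
  simp [rootPoly]

lemma splits_rootPoly {n : ℕ} (r : Fin n → ℝ) : (rootPoly r).Splits :=
  Splits.prod fun i _ => Splits.X_sub_C (r i)

lemma roots_rootPoly {n : ℕ} (r : Fin n → ℝ) : (rootPoly r).roots = Finset.univ.val.map r := by
  rw [rootPoly_eq_multiset, roots_multiset_prod_X_sub_C]

lemma exists_rootPoly_eq {n : ℕ} {p : ℝ[X]} (hp : p.Monic) (hn : p.natDegree = n)
    (hs : p.Splits) : ∃ r : Fin n → ℝ, p = rootPoly r := by
  have hcard : p.roots.toList.length = n := by
    rw [Multiset.length_toList, ← hn, hs.natDegree_eq_card_roots]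
  subst hcard
  refine ⟨fun i => p.roots.toList.get i, ?_⟩
  conv_lhs => rw [hs.eq_prod_roots_of_monic hp, ← Multiset.coe_toList p.roots]
  rw [rootPoly, Multiset.map_coe, Multiset.prod_coe, ← List.prod_ofFn]
  congr 1
  apply List.ext_getElem <;> simp

lemma rootPoly_scaleRoots {n : ℕ} (r : Fin n → ℝ) (t : ℝ) :
    (rootPoly r).scaleRoots t = rootPoly fun i => t * r i := by
  unfold rootPoly
  induction (Finset.univ : Finset (Fin n)) using Finset.induction_on with
  | empty => simp
  | insert a s ha ih =>
    rw [Finset.prod_insert ha, Finset.prod_insert ha, mul_scaleRoots_of_noZeroDivisors, ih,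
      X_sub_C_scaleRoots, mul_comm (r a)]

lemma rootPoly_comp_X_sub_C {n : ℕ} (r : Fin n → ℝ) (c : ℝ) :
    (rootPoly r).comp (X - C c) = rootPoly fun i => r i + c := by
  simp [rootPoly, Polynomial.prod_comp, sub_sub, add_comm]

lemma multiset_sum_sq {R : Type*} [CommRing R] (s : Multiset R) :
    (s.map fun x => x ^ 2).sum = s.sum ^ 2 - 2 * s.esymm 2 := by
  induction s using Multiset.induction_on with
  | empty => simp [Multiset.esymm, Multiset.powersetCard_zero_right]
  | cons a s ih =>
    have h : (a ::ₘ s).esymm 2 = s.esymm 2 + a * s.sum := by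
      have h' : (s.map fun x => a * x).sum = a * s.sum := by
        simpa using Multiset.sum_map_mul_left (s := s) (f := id) (a := a)
      simpa [Multiset.esymm, Multiset.powersetCard_cons, Multiset.powersetCard_one] using h'
    rw [Multiset.map_cons, Multiset.sum_cons, Multiset.sum_cons, ih, h]
    ring

lemma sum_roots_eq {n : ℕ} (r : Fin (n + 2) → ℝ) : ∑ i, r i = -(rootPoly r).coeff (n + 1) := by
  rw [rootPoly_eq_multiset, Finset.sum]
  generalize hs : (Finset.univ.val.map r) = s
  have hc : s.card = n + 2 := by rw [← hs, Multiset.card_map]; exact Finset.card_fin _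
  rw [Multiset.prod_X_sub_C_coeff _ (by lia), hc, show n + 2 - (n + 1) = 1 by lia]
  simp [Multiset.esymm, Multiset.powersetCard_one]

/-- Newton's identity. When the roots sum to zero, the single coefficient of index `n` bounds all of
them. -/
lemma sum_sq_roots_eq {n : ℕ} (r : Fin (n + 2) → ℝ) :
    ∑ i, r i ^ 2 = (rootPoly r).coeff (n + 1) ^ 2 - 2 * (rootPoly r).coeff n := by
  have h3 := sum_roots_eq r
  rw [← neg_sq, ← h3, rootPoly_eq_multiset]
  have hsq : ∑ i, r i ^ 2 = ((Finset.univ.val.map r).map fun x => x ^ 2).sum := by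
    rw [Multiset.map_map]; rfl
  rw [hsq, Finset.sum]
  generalize hs : (Finset.univ.val.map r) = s
  have hc : s.card = n + 2 := by rw [← hs, Multiset.card_map]; exact Finset.card_fin _
  rw [Multiset.prod_X_sub_C_coeff _ (by lia), hc, show n + 2 - n = 2 by lia, multiset_sum_sq]
  ring

lemma abs_coeff_rootPoly_le {n : ℕ} {r : Fin n → ℝ} {B : ℝ} (h : ∀ i, |r i| ≤ B) (i : ℕ) :
    |(rootPoly r).coeff i| ≤ B ^ (n - i) * n.choose i := by
  have := coeff_le_of_roots_le (f := RingHom.id ℝ) (B := B) i (rootPoly_monic r)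
    (by simpa using splits_rootPoly r) (by
      intro z hz
      rw [Polynomial.map_id, roots_rootPoly] at hz
      obtain ⟨j, -, rfl⟩ := Multiset.mem_map.1 hz
      exact h j)
  simpa using this

lemma continuous_coeff_rootPoly {n : ℕ} (i : ℕ) :
    Continuous fun r : Fin n → ℝ => (rootPoly r).coeff i := by
  unfold rootPoly
  induction (Finset.univ : Finset (Fin n)) using Finset.induction_on generalizing i with
  | empty => simpa using continuous_const
  | insert a s ha ih =>
    simp only [Finset.prod_insert ha, coeff_mul]
    refine continuous_finsetSum _ fun x _ => Continuous.mul ?_ (ih x.2)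
    simp only [coeff_sub, coeff_C]
    split_ifs <;> fun_prop

/-- Real-rootedness is preserved under limits, provided the roots stay bounded. -/
lemma exists_rootPoly_of_tendsto {n : ℕ} {l : Filter ℝ} [l.NeBot] {P : ℝ → ℝ[X]} {p : ℝ[X]}
    (hlim : ∀ i, Tendsto (fun t => (P t).coeff i) l (𝓝 (p.coeff i))) {B : ℝ}
    (h : ∀ᶠ t in l, ∃ r : Fin n → ℝ, (∀ i, |r i| ≤ B) ∧ P t = rootPoly r) :
    ∃ r : Fin n → ℝ, p = rootPoly r := by
  let Φ : (Fin n → ℝ) → ℕ → ℝ := fun r i => (rootPoly r).coeff i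
  have hΦ : Continuous Φ := continuous_pi fun i => continuous_coeff_rootPoly i
  -- Bounded root tuples form a compact cube, so their coefficient sequences form a closed set,
  -- which contains the limit.
  have hK : IsCompact (Φ '' Set.univ.pi fun _ => Set.Icc (-B) B) :=
    (isCompact_univ_pi fun _ => isCompact_Icc).image hΦ
  have hmem : (fun i => p.coeff i) ∈ Φ '' Set.univ.pi fun _ => Set.Icc (-B) B := by
    refine hK.isClosed.mem_of_tendsto (tendsto_pi_nhds.2 hlim) ?_
    filter_upwards [h] with t ⟨r, hr, ht⟩
    exact ⟨r, fun i _ => abs_le.1 (hr i), by simp [Φ, ht]⟩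
  obtain ⟨r, -, hr⟩ := hmem
  exact ⟨r, by ext i; exact (congrFun hr i).symm⟩

/-- The roots equal to `r i` are separated from the others. Both classes are nonempty, so both
degrees drop, as the induction on the degree requires. -/
lemma exists_coprime_factorization {n : ℕ} {r : Fin n → ℝ} {i j : Fin n} (h : r i ≠ r j) :
    ∃ (m k : ℕ) (p q : ℝ[X]), p.Monic ∧ q.Monic ∧ p.natDegree = m ∧ q.natDegree = k ∧
      IsCoprime p q ∧ rootPoly r = p * q ∧ n = m + k ∧ m < n ∧ k < n := by
  classical
  let S := Finset.univ.filter fun l => r l = r i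
  let T := Finset.univ.filter fun l => ¬ r l = r i
  have hST : S.card + T.card = n := by
    simpa using Finset.card_filter_add_card_filter_not (s := Finset.univ) fun l => r l = r i
  have hS : 0 < S.card := Finset.card_pos.2 ⟨i, by simp [S]⟩
  have hT : 0 < T.card := Finset.card_pos.2 ⟨j, by simp [T, h.symm]⟩
  refine ⟨S.card, T.card, ∏ l ∈ S, (X - C (r l)), ∏ l ∈ T, (X - C (r l)),
    monic_prod_of_monic _ _ fun l _ => monic_X_sub_C _,
    monic_prod_of_monic _ _ fun l _ => monic_X_sub_C _, by simp, by simp, ?_, ?_,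
    hST.symm, by lia, by lia⟩
  · refine IsCoprime.prod_left fun a ha => IsCoprime.prod_right fun b hb => ?_
    refine isCoprime_X_sub_C_of_isUnit_sub (isUnit_iff_ne_zero.2 (sub_ne_zero.2 ?_))
    simp only [S, T, Finset.mem_filter, Finset.mem_univ, true_and] at ha hb
    exact fun hab => hb (hab ▸ ha)
  · exact (Finset.prod_filter_mul_prod_filter_not _ _ _).symm

lemma rootPoly_append {m k : ℕ} (a : Fin m → ℝ) (b : Fin k → ℝ) :
    rootPoly (Fin.append a b) = rootPoly a * rootPoly b := by
  simp [rootPoly, Fin.prod_univ_add]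

/-! ### Orders of vanishing and the blow-up -/

/-- An analytic function which is `O(t ^ k)` is divisible by `t ^ k`. -/
lemma natCast_le_analyticOrderAt_of_bound {f : ℝ → ℝ} (hf : AnalyticAt ℝ f 0) {k : ℕ} {C : ℝ}
    (h : ∀ᶠ t in 𝓝 0, |f t| ≤ C * |t| ^ k) : (k : ℕ∞) ≤ analyticOrderAt f 0 := by
  by_contra! hlt
  obtain ⟨m, hm⟩ := ENat.ne_top_iff_exists.1 (ne_top_of_lt hlt)
  rw [← hm] at hlt
  have hmk : m < k := by exact_mod_cast hlt
  obtain ⟨g, hg, hg0, hfg⟩ := hf.analyticOrderAt_eq_natCast.1 hm.symm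
  -- Cancelling `|t| ^ m` leaves a positive power of `|t|` in the bound, which forces `g 0 = 0`.
  have hle : ∀ᶠ t in 𝓝[≠] (0 : ℝ), |g t| ≤ C * |t| ^ (k - m) := by
    filter_upwards [h.filter_mono nhdsWithin_le_nhds, hfg.filter_mono nhdsWithin_le_nhds,
      self_mem_nhdsWithin] with t h1 h2 ht
    have htp : 0 < |t| ^ m := pow_pos (abs_pos.2 ht) m
    rw [h2, sub_zero, smul_eq_mul, abs_mul, abs_pow, ← Nat.sub_add_cancel hmk.le, pow_add] at h1
    refine le_of_mul_le_mul_left ?_ htp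
    linarith
  have hlim1 : Tendsto (fun t => |g t|) (𝓝[≠] 0) (𝓝 |g 0|) :=
    hg.continuousAt.abs.tendsto.mono_left nhdsWithin_le_nhds
  have hlim2 : Tendsto (fun t : ℝ => C * |t| ^ (k - m)) (𝓝[≠] 0) (𝓝 0) := by
    have : Continuous fun t : ℝ => C * |t| ^ (k - m) := by fun_prop
    have h0 := this.tendsto 0
    simp only [abs_zero, zero_pow (Nat.sub_ne_zero_of_lt hmk), mul_zero] at h0
    exact h0.mono_left nhdsWithin_le_nhds
  have := le_of_tendsto_of_tendsto hlim1 hlim2 hle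
  exact hg0 (abs_nonpos_iff.1 this)

/-- A nonnegative analytic function vanishing at `0` vanishes to second order. -/
lemma two_le_analyticOrderAt_of_nonneg {f : ℝ → ℝ} (hf : AnalyticAt ℝ f 0) (h0 : f 0 = 0)
    (h : ∀ᶠ t in 𝓝 0, 0 ≤ f t) : ((2 : ℕ) : ℕ∞) ≤ analyticOrderAt f 0 := by
  rw [natCast_le_analyticOrderAt_iff_iteratedDeriv_eq_zero hf]
  have hmin : IsLocalMin f 0 := by filter_upwards [h] with t ht; rwa [h0]
  intro i hi
  interval_cases i
  · simpa using h0
  · simpa using hmin.deriv_eq_zero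

lemma coeff_polyOfCoeffs (m : ℕ) (u : Fin m → ℝ) (i : Fin m) :
    (polyOfCoeffs m u).coeff i = u i :=
  congrFun ((degreeLTEquiv ℝ m).apply_symm_apply u) i

/-- If all roots of a centred analytic family of real-rooted polynomials coalesce at `t = 0`, then
they are divisible by `t`, and the quotients are roots of another analytic family. -/
lemma exists_blowup {n : ℕ} {P : ℝ → ℝ[X]} (hP : ∀ i, AnalyticAt ℝ (fun t => (P t).coeff i) 0)
    (hs : ∀ᶠ t in 𝓝 0, ∃ r : Fin (n + 2) → ℝ, P t = rootPoly r)
    (hc : ∀ᶠ t in 𝓝 0, (P t).coeff (n + 1) = 0) (h0 : (P 0).coeff n = 0) :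
    ∃ Q : ℝ → ℝ[X], (∀ i, AnalyticAt ℝ (fun t => (Q t).coeff i) 0) ∧
      (∀ᶠ t in 𝓝 0, ∃ r : Fin (n + 2) → ℝ, Q t = rootPoly r) ∧
      ∀ᶠ t in 𝓝 0, P t = (Q t).scaleRoots t := by
  have hsq : ∀ᶠ t in 𝓝 0, ∀ r : Fin (n + 2) → ℝ, P t = rootPoly r →
      ∑ i, r i ^ 2 = -2 * (P t).coeff n := by
    filter_upwards [hc] with t ht r hr
    rw [sum_sq_roots_eq, ← hr, ht]
    ring
  -- The sum of squares is nonnegative and vanishes at `0`, hence to second order; so each root is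
  -- `O(t)`.
  obtain ⟨C, hC⟩ : ∃ C : ℝ, ∀ᶠ t in 𝓝 0, -2 * (P t).coeff n ≤ C * t ^ 2 := by
    have ha : AnalyticAt ℝ (fun t => -2 * (P t).coeff n) 0 := analyticAt_const.mul (hP n)
    have h2 := two_le_analyticOrderAt_of_nonneg ha (by simp [h0]) (by
      filter_upwards [hs, hsq] with t ⟨r, hr⟩ h
      rw [← h r hr]
      positivity)
    obtain ⟨g, hg, hfg⟩ := (natCast_le_analyticOrderAt ha).1 h2
    refine ⟨g 0 + 1, ?_⟩
    filter_upwards [hfg, hg.continuousAt.eventually_le_const (show g 0 < g 0 + 1 by linarith)]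
      with t h1 h3
    rw [h1, sub_zero, smul_eq_mul, mul_comm]
    gcongr
  have hbd : ∀ᶠ t in 𝓝 0, ∀ r : Fin (n + 2) → ℝ, P t = rootPoly r → ∀ i, |r i| ≤ √C * |t| := by
    filter_upwards [hsq, hC] with t h1 h2 r hr i
    have h3 : r i ^ 2 ≤ C * t ^ 2 :=
      (Finset.single_le_sum (f := fun i => r i ^ 2) (fun _ _ => sq_nonneg _)
        (Finset.mem_univ i)).trans ((h1 r hr).trans_le h2)
    rw [← Real.sqrt_sq_eq_abs t, ← Real.sqrt_mul' _ (sq_nonneg t)]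
    exact Real.abs_le_sqrt h3
  -- Up to sign, the coefficient of index `i` is a sum of products of `n + 2 - i` roots, each
  -- `O(t)`.
  have hdiv : ∀ i : Fin (n + 2), ∃ g : ℝ → ℝ, AnalyticAt ℝ g 0 ∧
      ∀ᶠ t in 𝓝 0, (P t).coeff i = t ^ (n + 2 - i) * g t := by
    intro i
    have := natCast_le_analyticOrderAt_of_bound (hP i) (k := n + 2 - i)
      (C := √C ^ (n + 2 - i) * (n + 2).choose i) (by
        filter_upwards [hs, hbd] with t ⟨r, hr⟩ h
        refine (hr ▸ abs_coeff_rootPoly_le (h r hr) i).trans_eq ?_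
        rw [mul_pow]
        ring)
    simpa using (natCast_le_analyticOrderAt (hP i)).1 this
  choose g hg hPg using hdiv
  let Q : ℝ → ℝ[X] := fun t => X ^ (n + 2) + polyOfCoeffs (n + 2) fun i => g i t
  have hQm : ∀ t, (Q t).Monic := fun t => monic_X_pow_add (degree_polyOfCoeffs_lt _ _)
  have hQd : ∀ t, (Q t).natDegree = n + 2 := fun t => by
    have := (degree_polyOfCoeffs_lt (n + 2) fun i => g i t)
    rw [natDegree_add_eq_left_of_degree_lt (by simpa using this), natDegree_X_pow]
  have hQc : ∀ i : Fin (n + 2), ∀ t, (Q t).coeff i = g i t := fun i t => by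
    simp only [Q, coeff_add, coeff_polyOfCoeffs, coeff_X_pow, if_neg i.2.ne, zero_add]
  have hQa : ∀ i, AnalyticAt ℝ (fun t => (Q t).coeff i) 0 := by
    intro i
    simp only [Q, coeff_add]
    refine analyticAt_const.add ?_
    exact ((lcoeff ℝ i ∘ₗ polyOfCoeffs (n + 2)).toContinuousLinearMap.analyticAt _).comp
      (analyticAt_pi_iff.2 hg)
  have hPQ : ∀ᶠ t in 𝓝 0, P t = (Q t).scaleRoots t := by
    filter_upwards [hs, eventually_all.2 hPg] with t ⟨r, hr⟩ h
    refine eq_of_lowCoeffs_eq (N := n + 2) (hr ▸ rootPoly_monic r)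
      ((monic_scaleRoots_iff t).2 (hQm t)) (by rw [hr, natDegree_rootPoly])
      (by rw [natDegree_scaleRoots, hQd]) ?_
    ext i
    simp only [lowCoeffs, LinearMap.pi_apply, lcoeff_apply, coeff_scaleRoots, hQd, hQc, h]
    ring
  refine ⟨Q, hQa, ?_, hPQ⟩
  -- For `t ≠ 0` the roots of `Q t` are those of `P t` divided by `t`, bounded by `√C`.
  -- Real-rootedness of `Q 0` then follows in the limit.
  have hpunct : ∀ᶠ t in 𝓝[≠] 0, ∃ r : Fin (n + 2) → ℝ, (∀ i, |r i| ≤ √C) ∧ Q t = rootPoly r := by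
    filter_upwards [hs.filter_mono nhdsWithin_le_nhds, hbd.filter_mono nhdsWithin_le_nhds,
      hPQ.filter_mono nhdsWithin_le_nhds, self_mem_nhdsWithin] with t ⟨r, hr⟩ h1 h2 ht
    have ht : t ≠ 0 := ht
    refine ⟨fun i => t⁻¹ * r i, fun i => ?_, ?_⟩
    · rw [abs_mul, abs_inv, inv_mul_le_iff₀ (abs_pos.2 ht), mul_comm]
      exact h1 r hr i
    · rw [← rootPoly_scaleRoots, ← hr, h2, ← scaleRoots_mul, mul_inv_cancel₀ ht, scaleRoots_one]
  have hzero := exists_rootPoly_of_tendsto (l := 𝓝[≠] 0) (p := Q 0)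
    (fun i => (hQa i).continuousAt.tendsto.mono_left nhdsWithin_le_nhds) hpunct
  rw [eventually_nhdsWithin_iff] at hpunct
  filter_upwards [hpunct] with t ht
  rcases eq_or_ne t 0 with rfl | h
  · exact hzero
  · obtain ⟨r, -, hr⟩ := ht h
    exact ⟨r, hr⟩

/-! ### Local analytic choice of roots -/

/-- `P` has `n` roots depending analytically on the parameter near `s`. -/
def HasAnalyticRoots (n : ℕ) (P : ℝ → ℝ[X]) (s : ℝ) : Prop :=
  ∃ lam : Fin n → ℝ → ℝ, (∀ k, AnalyticAt ℝ (lam k) s) ∧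
    ∀ᶠ t in 𝓝 s, P t = rootPoly fun k => lam k t

/-- A family of monic real-rooted polynomials with analytic coefficients near `s`. -/
structure IsAnalyticRealRooted (n : ℕ) (P : ℝ → ℝ[X]) (s : ℝ) : Prop where
  coeff : ∀ i, AnalyticAt ℝ (fun t => (P t).coeff i) s
  roots : ∀ᶠ t in 𝓝 s, ∃ r : Fin n → ℝ, P t = rootPoly r

/-- Hensel's lemma splits the family. Its factors divide a split polynomial, so they are real-rooted
and of smaller degree, where `ih` applies. -/
lemma HasAnalyticRoots.of_separated {n : ℕ} {P : ℝ → ℝ[X]}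
    (ih : ∀ m < n, ∀ Q, IsAnalyticRealRooted m Q 0 → HasAnalyticRoots m Q 0)
    (hP : IsAnalyticRealRooted n P 0) {r : Fin n → ℝ} (hr : P 0 = rootPoly r) {i j : Fin n}
    (hij : r i ≠ r j) : HasAnalyticRoots n P 0 := by
  obtain ⟨m, k, p, q, hp, hq, hpm, hqk, hco, hpq, hmk, hmn, hkn⟩ := exists_coprime_factorization hij
  obtain ⟨q', r', hq'a, hr'a, hq', hr', hfac⟩ := exists_analytic_factorization hp hq hpm hqk hco
    hP.coeff (by
      filter_upwards [hP.roots] with t ⟨r, hr⟩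
      rw [hr, ← hmk]
      exact ⟨rootPoly_monic r, natDegree_rootPoly r⟩) (hr.trans hpq)
  have hsplit : ∀ᶠ t in 𝓝 0, (q' t).Splits ∧ (r' t).Splits := by
    filter_upwards [hfac, hP.roots] with t ht ⟨r, hr⟩
    have hs : (P t).Splits := hr ▸ splits_rootPoly r
    have h0 : P t ≠ 0 := hr ▸ (rootPoly_monic r).ne_zero
    exact ⟨hs.of_dvd h0 (ht ▸ dvd_mul_right _ _), hs.of_dvd h0 (ht ▸ dvd_mul_left _ _)⟩
  obtain ⟨a, haa, ha⟩ := ih m hmn q' ⟨hq'a, by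
    filter_upwards [hsplit] with t ht using exists_rootPoly_eq (hq' t).1 (hq' t).2 ht.1⟩
  obtain ⟨b, hba, hb⟩ := ih k hkn r' ⟨hr'a, by
    filter_upwards [hsplit] with t ht using exists_rootPoly_eq (hr' t).1 (hr' t).2 ht.2⟩
  clear hr hij hpq
  subst hmk
  refine ⟨Fin.append a b, fun l => ?_, ?_⟩
  · refine Fin.addCases (fun l => ?_) (fun l => ?_) l
    · simpa using haa l
    · simpa using hba l
  · filter_upwards [hfac, ha, hb] with t h1 h2 h3
    rw [h1, h2, h3, ← rootPoly_append]
    congr 1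
    ext l
    refine Fin.addCases (fun l => ?_) (fun l => ?_) l <;> simp

/-- Induction on the vanishing order `d`: a blow-up lowers it by 2. Once the coefficient is nonzero
at `0`, centred roots cannot all coincide there and can be separated. -/
lemma HasAnalyticRoots.of_centred {n : ℕ}
    (ih : ∀ m < n + 2, ∀ Q, IsAnalyticRealRooted m Q 0 → HasAnalyticRoots m Q 0) (d : ℕ) :
    ∀ P : ℝ → ℝ[X], IsAnalyticRealRooted (n + 2) P 0 →
      (∀ᶠ t in 𝓝 0, (P t).coeff (n + 1) = 0) →
      analyticOrderAt (fun t => (P t).coeff n) 0 = d → HasAnalyticRoots (n + 2) P 0 := by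
  induction d using Nat.strong_induction_on with
  | _ d ihd =>
    intro P hP hc hd
    by_cases h0 : (P 0).coeff n = 0
    · obtain ⟨Q, hQa, hQs, hPQ⟩ := exists_blowup hP.coeff hP.roots hc h0
      have hPc : ∀ᶠ t in 𝓝 0, ∀ i, (P t).coeff i = (Q t).coeff i * t ^ (n + 2 - i) := by
        filter_upwards [hPQ, hQs] with t ht ⟨r, hr⟩ i
        rw [ht, coeff_scaleRoots, show (Q t).natDegree = n + 2 by rw [hr, natDegree_rootPoly]]
      have hQc : ∀ᶠ t in 𝓝 0, (Q t).coeff (n + 1) = 0 := by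
        -- Division by `t` gives the vanishing only for `t ≠ 0`; analyticity carries it across `0`.
        refine (hQa (n + 1)).frequently_zero_iff_eventually_zero.1 (Eventually.frequently ?_)
        filter_upwards [hPc.filter_mono nhdsWithin_le_nhds, hc.filter_mono nhdsWithin_le_nhds,
          self_mem_nhdsWithin] with t h1 h2 ht
        rw [h1, show n + 2 - (n + 1) = 1 by lia, pow_one] at h2
        exact (mul_eq_zero.1 h2).resolve_right ht
      have hord : analyticOrderAt (fun t => (P t).coeff n) 0 =
          analyticOrderAt (fun t => (Q t).coeff n) 0 + 2 := by
        have h1 : (fun t => (P t).coeff n) =ᶠ[𝓝 0] (fun t => (Q t).coeff n) * id ^ 2 := by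
          filter_upwards [hPc] with t ht
          simp [ht]
        rw [analyticOrderAt_congr h1, analyticOrderAt_mul (hQa n) (analyticAt_id.pow 2),
          analyticOrderAt_pow analyticAt_id]
        simp
      rw [hord] at hd
      obtain ⟨e, he⟩ := ENat.ne_top_iff_exists.1
        (show analyticOrderAt (fun t => (Q t).coeff n) 0 ≠ ⊤ by rintro h; simp [h] at hd)
      rw [← he] at hd
      have hed : e + 2 = d := by exact_mod_cast hd
      obtain ⟨lam, hlam, hQlam⟩ := ihd e (by lia) Q ⟨hQa, hQs⟩ hQc he.symm
      refine ⟨fun k t => t * lam k t, fun k => analyticAt_id.mul (hlam k), ?_⟩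
      filter_upwards [hPQ, hQlam] with t h1 h2
      rw [h1, h2, rootPoly_scaleRoots]
    · obtain ⟨r, hr⟩ := hP.roots.self_of_nhds
      by_cases hconst : ∀ i j, r i = r j
      · exfalso
        have h1 := sum_roots_eq r
        have h2 := sum_sq_roots_eq r
        rw [← hr, hc.self_of_nhds] at h1 h2
        have h3 : ∀ i, r i = r 0 := fun i => hconst i 0
        simp only [h3, Finset.sum_const, Finset.card_univ, Fintype.card_fin, nsmul_eq_mul] at h1 h2
        have h4 : r 0 = 0 := by
          rw [neg_zero] at h1
          exact (mul_eq_zero.1 h1).resolve_left (by positivity)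
        rw [h4] at h2
        apply h0
        linarith
      · push Not at hconst
        obtain ⟨i, j, hij⟩ := hconst
        exact .of_separated ih hP hr hij

lemma IsAnalyticRealRooted.hasAnalyticRoots_zero (n : ℕ) :
    ∀ P, IsAnalyticRealRooted n P 0 → HasAnalyticRoots n P 0 := by
  induction n using Nat.strong_induction_on with
  | _ n ih =>
    intro P hP
    match n with
    | 0 =>
      refine ⟨fun _ _ => 0, fun _ => analyticAt_const, ?_⟩
      filter_upwards [hP.roots] with t ⟨r, hr⟩
      rw [hr]
      congr 1
      exact Subsingleton.elim _ _
    | 1 =>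
      refine ⟨fun _ t => -(P t).coeff 0, fun _ => (hP.coeff 0).neg, ?_⟩
      filter_upwards [hP.roots] with t ⟨r, hr⟩
      rw [hr]
      congr 1
      ext i
      fin_cases i
      simp [rootPoly]
    | n + 2 =>
      -- The mean of the roots; translating by it centres the family.
      let c : ℝ → ℝ := fun t => -(P t).coeff (n + 1) / (n + 2)
      have hc : AnalyticAt ℝ c 0 := (hP.coeff _).neg.div_const
      let Q : ℝ → ℝ[X] := fun t => (P t).comp (X - C (-c t))
      have hQ : ∀ t, ∀ r : Fin (n + 2) → ℝ, P t = rootPoly r → Q t = rootPoly fun i => r i - c t := by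
        intro t r hr
        simp only [Q]
        rw [hr, rootPoly_comp_X_sub_C]
        simp only [sub_eq_add_neg]
      have hP' : ∀ t, ∀ r : Fin (n + 2) → ℝ, Q t = rootPoly r → P t = rootPoly fun i => r i + c t := by
        intro t r hr
        rw [← rootPoly_comp_X_sub_C, ← hr]
        simp [Q, comp_assoc]
      have hQs : ∀ᶠ t in 𝓝 0, ∃ r : Fin (n + 2) → ℝ, Q t = rootPoly r := by
        filter_upwards [hP.roots] with t ⟨r, hr⟩ using ⟨_, hQ t r hr⟩
      have hQa : ∀ i, AnalyticAt ℝ (fun t => (Q t).coeff i) 0 := by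
        intro i
        -- The ranges do not depend on `t`, so the coefficient is a fixed finite expression in
        -- analytic functions.
        have : (fun t => (Q t).coeff i) =ᶠ[𝓝 0] fun t => ∑ j ∈ Finset.range (n + 3),
            (P t).coeff j * ∑ l ∈ Finset.range (j + 1), c t ^ (j - l) * (j.choose l) *
              (if l = i then 1 else 0) := by
          filter_upwards [hP.roots] with t ⟨r, hr⟩
          have hdeg : (P t).natDegree < n + 3 := by rw [hr, natDegree_rootPoly]; lia
          simp only [Q]
          rw [comp, eval₂_eq_sum_range' _ hdeg, finsetSum_coeff]
          refine Finset.sum_congr rfl fun j _ => ?_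
          rw [coeff_C_mul, C_neg, sub_neg_eq_add, add_pow, finsetSum_coeff]
          congr 1
          refine Finset.sum_congr rfl fun l _ => ?_
          rw [← C_pow, ← C_eq_natCast, mul_assoc, ← C_mul, coeff_mul_C, coeff_X_pow]
          simp only [eq_comm (a := i)]
          ring
        refine AnalyticAt.congr ?_ this.symm
        refine Finset.analyticAt_fun_sum _ fun j _ => (hP.coeff j).mul ?_
        exact Finset.analyticAt_fun_sum _ fun l _ =>
          ((hc.pow _).mul analyticAt_const).mul analyticAt_const
      have hQc : ∀ᶠ t in 𝓝 0, (Q t).coeff (n + 1) = 0 := by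
        filter_upwards [hP.roots] with t ⟨r, hr⟩
        have h1 := sum_roots_eq r
        have h2 := sum_roots_eq fun i => r i - c t
        rw [← hQ t r hr, Finset.sum_sub_distrib, h1, ← hr] at h2
        simp only [Finset.sum_const, Finset.card_univ, Fintype.card_fin, nsmul_eq_mul, c] at h2
        push_cast at h2
        field_simp at h2
        linarith
      suffices HasAnalyticRoots (n + 2) Q 0 by
        obtain ⟨lam, hlam, h⟩ := this
        refine ⟨fun k t => lam k t + c t, fun k => (hlam k).add hc, ?_⟩
        filter_upwards [h] with t ht using hP' t _ ht
      -- At infinite order the sum of squares is zero near `0`, so all centred roots vanish; finite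
      -- order starts the induction on `d`.
      rcases eq_or_ne (analyticOrderAt (fun t => (Q t).coeff n) 0) ⊤ with htop | htop
      · refine ⟨fun _ _ => 0, fun _ => analyticAt_const, ?_⟩
        filter_upwards [hQs, hQc, analyticOrderAt_eq_top.1 htop] with t ⟨r, hr⟩ h1 h2
        have h3 := sum_sq_roots_eq r
        rw [← hr, h1, h2] at h3
        rw [hr]
        congr 1
        ext i
        have h4 := (Finset.sum_eq_zero_iff_of_nonneg fun i _ => sq_nonneg (r i)).1
          (h3.trans (by ring)) i (Finset.mem_univ i)
        exact pow_eq_zero_iff (two_ne_zero) |>.1 h4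
      · obtain ⟨d, hd⟩ := ENat.ne_top_iff_exists.1 htop
        exact HasAnalyticRoots.of_centred ih d Q ⟨hQa, hQs⟩ hQc hd.symm

/-- **Rellich's theorem for polynomials**, local form: the roots of a one-parameter analytic family
of real-rooted monic polynomials can be chosen analytically. -/
theorem IsAnalyticRealRooted.hasAnalyticRoots {n : ℕ} {P : ℝ → ℝ[X]} {s : ℝ}
    (hP : IsAnalyticRealRooted n P s) : HasAnalyticRoots n P s := by
  have hadd : Tendsto (fun t : ℝ => s + t) (𝓝 0) (𝓝 s) := by
    have : ContinuousAt (fun t : ℝ => s + t) 0 := by fun_prop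
    simpa [ContinuousAt] using this
  have hsub : Tendsto (fun t : ℝ => t - s) (𝓝 s) (𝓝 0) := by
    have : ContinuousAt (fun t : ℝ => t - s) s := by fun_prop
    simpa [ContinuousAt] using this
  obtain ⟨lam, hlam, h⟩ := hasAnalyticRoots_zero n (fun t => P (s + t))
    ⟨fun i => AnalyticAt.comp (g := fun t => (P t).coeff i) (f := fun t => s + t)
      (by simpa using hP.coeff i) (by fun_prop), hadd.eventually hP.roots⟩
  refine ⟨fun k t => lam k (t - s), fun k => AnalyticAt.comp (f := fun t => t - s)
    (by simpa using hlam k) (by fun_prop), ?_⟩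
  filter_upwards [hsub.eventually h] with t ht
  simpa using ht

lemma isRoot_rootPoly_iff {n : ℕ} {r : Fin n → ℝ} {x : ℝ} :
    (rootPoly r).eval x = 0 ↔ ∃ k, x = r k := by
  simp [rootPoly, eval_prod, Finset.prod_eq_zero_iff, sub_eq_zero]

/-! ### Analytic continuation of roots to the whole line -/

section Continuation

variable {n : ℕ} {P : ℝ → ℝ[X]}

/-- An analytic root on a convex open set coincides with an analytic root near each boundary point.
-/
lemma exists_analytic_root_near (hloc : ∀ s, HasAnalyticRoots n P s) {I : Set ℝ} (hI : IsOpen I)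
    (hIc : Convex ℝ I) {f : ℝ → ℝ} (hf : AnalyticOnNhd ℝ f I)
    (hroot : ∀ t ∈ I, (P t).eval (f t) = 0) {s : ℝ} (hs : s ∈ closure I) :
    ∃ g : ℝ → ℝ, ∀ᶠ t in 𝓝 s, AnalyticAt ℝ g t ∧ (P t).eval (g t) = 0 ∧ (t ∈ I → f t = g t) := by
  obtain ⟨lam, hlam, hP⟩ := hloc s
  have hev : ∀ᶠ t in 𝓝 s, (∀ k, AnalyticAt ℝ (lam k) t) ∧ P t = rootPoly fun k => lam k t :=
    (eventually_all.2 fun k => (hlam k).eventually_analyticAt).and hP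
  obtain ⟨ε, hε, hball⟩ := Metric.eventually_nhds_iff_ball.1 hev
  obtain ⟨z, hzI, hz⟩ := Metric.mem_closure_iff.1 hs ε hε
  have hzU : z ∈ I ∩ Metric.ball s ε := ⟨hzI, by rwa [Metric.mem_ball, dist_comm]⟩
  have hU : IsOpen (I ∩ Metric.ball s ε) := hI.inter Metric.isOpen_ball
  have hUc : IsPreconnected (I ∩ Metric.ball s ε) :=
    (hIc.inter (convex_ball s ε)).isPreconnected
  have hfreq : ∃ᶠ t in 𝓝[≠] z, ∃ k, f t = lam k t := by
    refine Eventually.frequently ?_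
    filter_upwards [mem_nhdsWithin_of_mem_nhds (hU.mem_nhds hzU)] with t ht
    rw [← isRoot_rootPoly_iff (r := fun k => lam k t), ← (hball t ht.2).2]
    exact hroot t ht.1
  -- Pigeonhole: among finitely many local roots, one agrees with `f` at points accumulating at `z`,
  -- and the identity theorem applies.
  obtain ⟨k, hk⟩ : ∃ k, ∃ᶠ t in 𝓝[≠] z, f t = lam k t := by
    by_contra! h
    exact hfreq (by
      filter_upwards [eventually_all.2 h] with t ht ⟨k, hk⟩ using ht k hk)
  have heq := AnalyticOnNhd.eqOn_of_preconnected_of_frequently_eq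
    (fun t ht => hf t ht.1) (fun t ht => (hball t ht.2).1 k) hUc hzU hk
  refine ⟨lam k, ?_⟩
  filter_upwards [Metric.ball_mem_nhds s hε] with t ht
  refine ⟨(hball t ht).1 k, ?_, fun htI => heq ⟨htI, ht⟩⟩
  rw [(hball t ht).2, isRoot_rootPoly_iff]
  exact ⟨k, rfl⟩

/-- `g` continues the germ of `f` at `0` as an analytic root of `P` on `(-b, b)`. -/
structure IsRootContinuation (P : ℝ → ℝ[X]) (f : ℝ → ℝ) (I : Set ℝ) (g : ℝ → ℝ) : Prop where
  analytic : AnalyticOnNhd ℝ g I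
  root : ∀ t ∈ I, (P t).eval (g t) = 0
  germ : g =ᶠ[𝓝 0] f

lemma IsRootContinuation.eqOn {f g₁ g₂ : ℝ → ℝ} {b₁ b₂ t : ℝ}
    (h₁ : IsRootContinuation P f (Set.Ioo (-b₁) b₁) g₁)
    (h₂ : IsRootContinuation P f (Set.Ioo (-b₂) b₂) g₂) (ht₁ : |t| < b₁) (ht₂ : |t| < b₂) :
    g₁ t = g₂ t := by
  set b := min b₁ b₂
  have hb : |t| < b := lt_min ht₁ ht₂
  have hb₁ : Set.Ioo (-b) b ⊆ Set.Ioo (-b₁) b₁ :=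
    Set.Ioo_subset_Ioo (neg_le_neg (min_le_left _ _)) (min_le_left _ _)
  have hb₂ : Set.Ioo (-b) b ⊆ Set.Ioo (-b₂) b₂ :=
    Set.Ioo_subset_Ioo (neg_le_neg (min_le_right _ _)) (min_le_right _ _)
  have hb0 : 0 < b := (abs_nonneg t).trans_lt hb
  exact AnalyticOnNhd.eqOn_of_preconnected_of_eventuallyEq (h₁.analytic.mono hb₁)
    (h₂.analytic.mono hb₂) isPreconnected_Ioo ⟨by linarith, hb0⟩ (h₁.germ.trans h₂.germ.symm)
    (abs_lt.1 hb)

/-- Continuations to symmetric intervals glue. -/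
lemma exists_rootContinuation_iUnion {f : ℝ → ℝ} {S : Set ℝ} (hS : S.Nonempty)
    (hpos : ∀ b ∈ S, 0 < b)
    (h : ∀ b ∈ S, ∃ g, IsRootContinuation P f (Set.Ioo (-b) b) g) :
    ∃ g, IsRootContinuation P f {t | ∃ b ∈ S, |t| < b} g := by
  choose! g hg using h
  choose! β hβS hβ using fun (t : ℝ) (ht : ∃ b ∈ S, |t| < b) => ht
  have key : ∀ b ∈ S, ∀ t ∈ Set.Ioo (-b) b, g (β t) t = g b t := by
    intro b hb t ht
    have ht' : ∃ b ∈ S, |t| < b := ⟨b, hb, abs_lt.2 ht⟩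
    exact (hg _ (hβS t ht')).eqOn (hg b hb) (hβ t ht') (abs_lt.2 ht)
  refine ⟨fun t => g (β t) t, ?_, ?_, ?_⟩
  · rintro t ⟨b, hb, ht⟩
    refine ((hg b hb).analytic t (abs_lt.1 ht)).congr ?_
    filter_upwards [Ioo_mem_nhds (abs_lt.1 ht).1 (abs_lt.1 ht).2] with x hx
    exact (key b hb x hx).symm
  · rintro t ⟨b, hb, ht⟩
    have := (hg b hb).root t (abs_lt.1 ht)
    rwa [← key b hb t (abs_lt.1 ht)] at this
  · obtain ⟨b, hb⟩ := hS
    filter_upwards [Ioo_mem_nhds (neg_lt_zero.2 (hpos b hb)) (hpos b hb), (hg b hb).germ] with t h1 h2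
    rw [key b hb t h1, h2]

/-- Local roots at `c` and `-c` agree with `g` inside the interval, so the three pieces paste
together. -/
lemma IsRootContinuation.extend (hloc : ∀ s, HasAnalyticRoots n P s) {f g : ℝ → ℝ} {c : ℝ}
    (hc : 0 < c) (h : IsRootContinuation P f (Set.Ioo (-c) c) g) :
    ∃ b > c, ∃ g', IsRootContinuation P f (Set.Ioo (-b) b) g' := by
  have hcl : closure (Set.Ioo (-c) c) = Set.Icc (-c) c := closure_Ioo (by linarith)
  obtain ⟨u, hu⟩ := exists_analytic_root_near hloc isOpen_Ioo (convex_Ioo _ _) h.analytic h.root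
    (s := c) (hcl ▸ ⟨by linarith, le_rfl⟩)
  obtain ⟨v, hv⟩ := exists_analytic_root_near hloc isOpen_Ioo (convex_Ioo _ _) h.analytic h.root
    (s := -c) (hcl ▸ ⟨le_rfl, by linarith⟩)
  obtain ⟨ε₁, hε₁, hu⟩ := Metric.eventually_nhds_iff_ball.1 hu
  obtain ⟨ε₂, hε₂, hv⟩ := Metric.eventually_nhds_iff_ball.1 hv
  simp only [Real.ball_eq_Ioo] at hu hv
  -- The cap at `c` keeps the inner half of each overlap inside `(-c, c)`.
  set ε := min (min ε₁ ε₂) c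
  have hε : 0 < ε := lt_min (lt_min hε₁ hε₂) hc
  have hεc : ε ≤ c := min_le_right _ _
  have h1 : ε ≤ ε₁ := (min_le_left _ _).trans (min_le_left _ _)
  have h2 : ε ≤ ε₂ := (min_le_left _ _).trans (min_le_right _ _)
  let F : ℝ → ℝ := fun t => if c ≤ t then u t else if t ≤ -c then v t else g t
  have hFg : ∀ t ∈ Set.Ioo (-c) c, F t = g t := fun t ht => by
    simp [F, not_le.2 ht.1, not_le.2 ht.2]
  have hFu : ∀ t ∈ Set.Ioo (c - ε) (c + ε), F t = u t := fun t ht => by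
    by_cases htc : c ≤ t
    · simp [F, htc]
    · have hI : t ∈ Set.Ioo (-c) c := ⟨by linarith [ht.1], not_le.1 htc⟩
      rw [hFg t hI, (hu t ⟨by linarith [ht.1], by linarith [ht.2]⟩).2.2 hI]
  have hFv : ∀ t ∈ Set.Ioo (-c - ε) (-c + ε), F t = v t := fun t ht => by
    by_cases htc : t ≤ -c
    · simp [F, htc, show ¬ c ≤ t by linarith]
    · have hI : t ∈ Set.Ioo (-c) c := ⟨not_le.1 htc, by linarith [ht.2]⟩
      rw [hFg t hI, (hv t ⟨by linarith [ht.1], by linarith [ht.2]⟩).2.2 hI]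
  have hcov : ∀ t ∈ Set.Ioo (-(c + ε)) (c + ε), t ∈ Set.Ioo (-c) c ∨ t ∈ Set.Ioo (c - ε) (c + ε) ∨
      t ∈ Set.Ioo (-c - ε) (-c + ε) := by
    intro t ht
    simp only [Set.mem_Ioo] at ht ⊢
    by_cases h3 : c ≤ t
    · exact Or.inr (Or.inl ⟨by linarith, ht.2⟩)
    · by_cases h4 : t ≤ -c
      · exact Or.inr (Or.inr ⟨by linarith, by linarith⟩)
      · exact Or.inl ⟨not_le.1 h4, not_le.1 h3⟩
  refine ⟨c + ε, by linarith, F, ?_, ?_, ?_⟩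
  · intro t ht
    rcases hcov t ht with h3 | h3 | h3
    · refine (h.analytic t h3).congr ?_
      filter_upwards [isOpen_Ioo.mem_nhds h3] with x hx using (hFg x hx).symm
    · refine (hu t ⟨by linarith [h3.1], by linarith [h3.2]⟩).1.congr ?_
      filter_upwards [isOpen_Ioo.mem_nhds h3] with x hx using (hFu x hx).symm
    · refine (hv t ⟨by linarith [h3.1], by linarith [h3.2]⟩).1.congr ?_
      filter_upwards [isOpen_Ioo.mem_nhds h3] with x hx using (hFv x hx).symm
  · intro t ht
    rcases hcov t ht with h3 | h3 | h3
    · rw [hFg t h3]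
      exact h.root t h3
    · rw [hFu t h3]
      exact (hu t ⟨by linarith [h3.1], by linarith [h3.2]⟩).2.1
    · rw [hFv t h3]
      exact (hv t ⟨by linarith [h3.1], by linarith [h3.2]⟩).2.1
  · filter_upwards [Ioo_mem_nhds (neg_lt_zero.2 hc) hc, h.germ] with t h3 h4
    rw [hFg t h3, h4]

/-- If the radii of continuation were bounded, their supremum would itself be reached by gluing and
then exceeded by `IsRootContinuation.extend`. -/
lemma exists_global_rootContinuation (hloc : ∀ s, HasAnalyticRoots n P s) {f : ℝ → ℝ}
    (hf : AnalyticAt ℝ f 0) (hroot : ∀ᶠ t in 𝓝 0, (P t).eval (f t) = 0) :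
    ∃ g, IsRootContinuation P f Set.univ g := by
  let S : Set ℝ := {b | 0 < b ∧ ∃ g, IsRootContinuation P f (Set.Ioo (-b) b) g}
  have hS : S.Nonempty := by
    obtain ⟨ε, hε, h⟩ := Metric.eventually_nhds_iff_ball.1 (hf.eventually_analyticAt.and hroot)
    simp only [Real.ball_eq_Ioo, zero_sub, zero_add] at h
    exact ⟨ε, hε, f, fun t ht => (h t ht).1, fun t ht => (h t ht).2, EventuallyEq.rfl⟩
  obtain ⟨g, hg⟩ := exists_rootContinuation_iUnion hS (fun b hb => hb.1) fun b hb => hb.2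
  by_cases hU : {t : ℝ | ∃ b ∈ S, |t| < b} = Set.univ
  · exact ⟨g, hU ▸ hg⟩
  exfalso
  obtain ⟨x, hx⟩ := (Set.ne_univ_iff_exists_notMem _).1 hU
  simp only [Set.mem_ofPred_eq, not_exists, not_and, not_lt] at hx
  have hbdd : BddAbove S := ⟨|x|, hx⟩
  have hUc : {t : ℝ | ∃ b ∈ S, |t| < b} = Set.Ioo (-sSup S) (sSup S) := by
    ext t
    simp only [Set.mem_ofPred_eq, Set.mem_Ioo, ← abs_lt]
    exact ⟨fun ⟨b, hb, ht⟩ => ht.trans_le (le_csSup hbdd hb), fun ht => exists_lt_of_lt_csSup hS ht⟩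
  have hpos : 0 < sSup S := by
    obtain ⟨b, hb⟩ := hS
    exact hb.1.trans_le (le_csSup hbdd hb)
  rw [hUc] at hg
  obtain ⟨b, hb, hext⟩ := hg.extend hloc hpos
  exact (le_csSup hbdd (show b ∈ S from ⟨hpos.trans hb, hext⟩)).not_gt hb

end Continuation

/-- **Rellich's theorem for polynomials**: the roots of an analytic family of real-rooted monic
polynomials on the line can be chosen analytically on the whole line. -/
theorem exists_analyticOnNhd_roots {n : ℕ} {P : ℝ → ℝ[X]} (hP : ∀ s, IsAnalyticRealRooted n P s)
    (hev : ∀ x, AnalyticOnNhd ℝ (fun t => (P t).eval x) Set.univ) :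
    ∃ lam : Fin n → ℝ → ℝ, (∀ k, AnalyticOnNhd ℝ (lam k) Set.univ) ∧
      ∀ t, P t = rootPoly fun k => lam k t := by
  obtain ⟨mu, hmu, h⟩ := (hP 0).hasAnalyticRoots
  have hex : ∀ k, ∃ g, IsRootContinuation P (mu k) Set.univ g := fun k =>
    exists_global_rootContinuation (fun s => (hP s).hasAnalyticRoots) (hmu k) (by
      filter_upwards [h] with t ht
      rw [ht, isRoot_rootPoly_iff]
      exact ⟨k, rfl⟩)
  choose lam hlam using hex
  refine ⟨lam, fun k => (hlam k).analytic, fun t => Polynomial.funext fun x => ?_⟩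
  -- Being roots for each `t` does not settle multiplicities. The identity theorem, at fixed `x`,
  -- carries the whole factorization from near `0` to the line.
  have heq : (fun t => (P t).eval x) = fun t => ∏ k, (x - lam k t) := by
    refine AnalyticOnNhd.eq_of_eventuallyEq (z₀ := 0) (hev x) ?_ ?_
    · intro t _
      exact Finset.analyticAt_fun_prod _ fun k _ =>
        analyticAt_const.sub ((hlam k).analytic t (Set.mem_univ t))
    · filter_upwards [h, eventually_all.2 fun k => (hlam k).germ] with t h1 h2
      simp [h1, rootPoly, eval_prod, h2]
  rw [congrFun heq t]
  simp [rootPoly, eval_prod]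

/-! ### The ring of Nash functions -/

/-- The ring of real-analytic functions on the line. -/
def analyticFunctions : Subring (ℝ → ℝ) where
  carrier := {f | AnalyticOnNhd ℝ f Set.univ}
  mul_mem' hf hg := hf.mul hg
  one_mem' := analyticOnNhd_const
  add_mem' hf hg := hf.add hg
  zero_mem' := analyticOnNhd_const
  neg_mem' hf := hf.neg

instance : NoZeroDivisors analyticFunctions where
  eq_zero_or_eq_zero_of_mul_eq_zero := by
    intro f g h
    have h' : ∀ t ∈ Set.univ, f.1 t * g.1 t = 0 := fun t _ => congrFun (congrArg Subtype.val h) t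
    refine (AnalyticOnNhd.eq_zero_or_eq_zero_of_mul_eq_zero f.2 g.2 h' isPreconnected_univ).imp
      (fun h => ?_) fun h => ?_
    all_goals exact Subtype.ext (funext fun t => h t (Set.mem_univ t))

instance : IsDomain analyticFunctions := NoZeroDivisors.to_isDomain _

/-- Polynomials as analytic functions. -/
noncomputable def polynomialToAnalytic : ℝ[X] →+* analyticFunctions :=
  (RingHom.pi fun t => evalRingHom t).codRestrict analyticFunctions
    fun p t _ => AnalyticOnNhd.eval_polynomial p t (Set.mem_univ t)

noncomputable instance : Algebra ℝ[X] analyticFunctions := polynomialToAnalytic.toAlgebra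

lemma algebraMap_analytic_apply (p : ℝ[X]) (t : ℝ) :
    (algebraMap ℝ[X] analyticFunctions p).1 t = p.eval t := rfl

/-- The ring of Nash functions: analytic functions on the line algebraic over the polynomials. -/
def Nash : Type := Subalgebra.algebraicClosure ℝ[X] analyticFunctions

namespace Nash

noncomputable instance : CommRing Nash :=
  inferInstanceAs (CommRing (Subalgebra.algebraicClosure ℝ[X] analyticFunctions))

instance : IsDomain Nash :=
  inferInstanceAs (IsDomain (Subalgebra.algebraicClosure ℝ[X] analyticFunctions))

noncomputable instance : Algebra ℝ[X] Nash :=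
  inferInstanceAs (Algebra ℝ[X] (Subalgebra.algebraicClosure ℝ[X] analyticFunctions))

instance : Algebra.IsAlgebraic ℝ[X] Nash :=
  inferInstanceAs
    (Algebra.IsAlgebraic ℝ[X] (Subalgebra.algebraicClosure ℝ[X] analyticFunctions))

/-- An analytic function algebraic over the polynomials, as a Nash function. -/
def ofAlgebraic (f : analyticFunctions) (hf : IsAlgebraic ℝ[X] f) : Nash := Subtype.mk f hf

/-- Evaluation of Nash functions. -/
noncomputable def ev (t : ℝ) : Nash →+* ℝ :=
  (Pi.evalRingHom (fun _ : ℝ => ℝ) t).comp (analyticFunctions.subtype.comp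
    (Subalgebra.algebraicClosure ℝ[X] analyticFunctions).val.toRingHom)

lemma ev_apply (t : ℝ) (f : Nash) : ev t f = f.1.1 t := rfl

@[simp] lemma ev_ofAlgebraic (t : ℝ) (f : analyticFunctions) (hf : IsAlgebraic ℝ[X] f) :
    ev t (ofAlgebraic f hf) = f.1 t := rfl

lemma ext_ev {f g : Nash} (h : ∀ t, ev t f = ev t g) : f = g :=
  Subtype.ext (Subtype.ext (funext h))

lemma analytic (f : Nash) : AnalyticOnNhd ℝ (fun t => ev t f) Set.univ := f.1.2

@[simp] lemma ev_algebraMap (t : ℝ) (p : ℝ[X]) : ev t (algebraMap ℝ[X] Nash p) = p.eval t := rfl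

/-- Every nonzero Nash function divides a nonzero polynomial. -/
lemma exists_polynomial {f : Nash} (hf : f ≠ 0) :
    ∃ p : ℝ[X], p ≠ 0 ∧ ∃ g : Nash, f * g = algebraMap ℝ[X] Nash p := by
  obtain ⟨p, hp, g, hg⟩ := IsAlgebraic.exists_nonzero_dvd (R := ℝ[X])
    (Algebra.IsAlgebraic.isAlgebraic f) (mem_nonZeroDivisors_of_ne_zero hf)
  exact ⟨p, hp, g, hg.symm⟩

lemma finite_zeros {f : Nash} (hf : f ≠ 0) : {t : ℝ | ev t f = 0}.Finite := by
  obtain ⟨p, hp, g, hg⟩ := exists_polynomial hf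
  refine p.rootSet_finite ℝ |>.subset fun t ht => ?_
  have h : ev t f * ev t g = p.eval t := by rw [← map_mul, hg, ev_algebraMap]
  rw [show ev t f = 0 from ht, zero_mul] at h
  rw [mem_rootSet]
  exact ⟨hp, by simpa using h.symm⟩

/-- Division of a Nash function by a linear factor at one of its zeros. -/
lemma exists_eq_mul {f : Nash} {a : ℝ} (h : ev a f = 0) :
    ∃ g : Nash, f = algebraMap ℝ[X] Nash (X - C a) * g := by
  have hmul : ∀ t, (t - a) * dslope f.1.1 a t = f.1.1 t := by
    intro t
    have := sub_smul_dslope f.1.1 a t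
    rwa [← ev_apply a, h, sub_zero, smul_eq_mul] at this
  have hg : AnalyticOnNhd ℝ (dslope f.1.1 a) Set.univ := by
    intro t _
    rcases eq_or_ne t a with rfl | hta
    · obtain ⟨p, hp⟩ := f.1.2 t (Set.mem_univ t)
      exact ⟨_, hp.has_fpower_series_dslope_fslope⟩
    · have h1 : AnalyticAt ℝ (fun x => f.1.1 x / (x - a)) t :=
        (f.1.2 t (Set.mem_univ t)).div (by fun_prop) (sub_ne_zero.2 hta)
      refine h1.congr ?_
      filter_upwards [isOpen_ne.mem_nhds hta] with x hx
      rw [← hmul x, mul_div_cancel_left₀ _ (sub_ne_zero.2 hx)]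
  let g : analyticFunctions := ⟨dslope f.1.1 a, hg⟩
  have hfg : algebraMap ℝ[X] analyticFunctions (X - C a) * g = f.1 := by
    refine Subtype.ext (funext fun t => ?_)
    change (X - C a).eval t * dslope f.1.1 a t = f.1.1 t
    simpa using hmul t
  have hne : algebraMap ℝ[X] analyticFunctions (X - C a) ≠ 0 := by
    intro h0
    have := congrFun (congrArg Subtype.val h0) (a + 1)
    rw [algebraMap_analytic_apply] at this
    simp at this
  -- The product of `g` with a nonzero polynomial is the algebraic element `f`, so `g` is algebraic.
  have halg : IsAlgebraic ℝ[X] g :=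
    IsAlgebraic.of_mul (mem_nonZeroDivisors_of_ne_zero hne) (isAlgebraic_algebraMap _)
      (hfg ▸ f.2)
  exact ⟨ofAlgebraic g halg, Subtype.ext hfg.symm⟩

/-- A positive Nash function is the inverse of a square. -/
lemma exists_sq_mul_eq_one {f : Nash} (h : ∀ t, 0 < ev t f) : ∃ g : Nash, g ^ 2 * f = 1 := by
  have hg : AnalyticOnNhd ℝ (fun t => (√(f.1.1 t))⁻¹) Set.univ := by
    intro t ht
    have h1 : ContDiffAt ℝ ⊤ (fun t => √(f.1.1 t)) t :=
      (f.1.2 t ht).contDiffAt.sqrt (h t).ne'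
    exact h1.analyticAt.inv (Real.sqrt_pos.2 (h t)).ne'
  let g : analyticFunctions := ⟨_, hg⟩
  have hfg : g ^ 2 * f.1 = 1 := by
    refine Subtype.ext (funext fun t => ?_)
    change ((√(f.1.1 t))⁻¹) ^ 2 * f.1.1 t = 1
    have ht : 0 < f.1.1 t := h t
    rw [inv_pow, Real.sq_sqrt ht.le, inv_mul_cancel₀ ht.ne']
  have hf0 : f.1 ≠ 0 := by
    rintro h0
    simp [h0] at hfg
  have halg : IsAlgebraic ℝ[X] g := by
    refine IsAlgebraic.of_pow two_pos ?_
    refine IsAlgebraic.of_mul (mem_nonZeroDivisors_of_ne_zero hf0) f.2 ?_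
    rw [mul_comm, hfg]
    exact isAlgebraic_one
  exact ⟨ofAlgebraic g halg, Subtype.ext hfg⟩

/-! ### Spectral theorem over the Nash functions -/

section Vectors

/-- Every nonzero vector of Nash functions is a multiple of a nowhere vanishing one. -/
lemma exists_primitive {ι : Type*} {v : ι → Nash} (hv : v ≠ 0) :
    ∃ (c : Nash) (w : ι → Nash), c ≠ 0 ∧ v = c • w ∧ ∀ t, ∃ i, ev t (w i) ≠ 0 := by
  obtain ⟨i, hi⟩ := Function.ne_iff.1 hv
  obtain ⟨p, hp, g, hg⟩ := exists_polynomial hi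
  clear hv hi
  -- `p` is a polynomial multiple of one fixed entry, so a common zero `a` of all entries is a root
  -- of `p`. Dividing the vector by `t - a` lowers the degree of `p`.
  induction hd : p.natDegree using Nat.strong_induction_on generalizing v p with
  | _ d ih =>
    by_cases h : ∀ t, ∃ i, ev t (v i) ≠ 0
    · exact ⟨1, v, one_ne_zero, by simp, h⟩
    push Not at h
    obtain ⟨a, ha⟩ := h
    choose w hw using fun j => exists_eq_mul (ha j)
    have hroot : p.IsRoot a := by
      have h1 := congrArg (ev a) hg
      rw [map_mul, ha, zero_mul, ev_algebraMap] at h1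
      exact h1.symm
    obtain ⟨q, rfl⟩ := dvd_iff_isRoot.2 hroot
    have hX : algebraMap ℝ[X] Nash (X - C a) ≠ 0 := by
      intro h0
      have := congrArg (ev (a + 1)) h0
      simp at this
    have hq : q ≠ 0 := right_ne_zero_of_mul hp
    obtain ⟨c, u, hc, hu, hu'⟩ := ih q.natDegree (by
        rw [← hd, natDegree_mul (X_sub_C_ne_zero a) hq, natDegree_X_sub_C]
        lia) (v := w) (p := q) hq (by
        refine mul_left_cancel₀ hX ?_
        rw [← mul_assoc, ← hw i, hg, map_mul]) rfl
    refine ⟨algebraMap ℝ[X] Nash (X - C a) * c, u, mul_ne_zero hX hc, ?_, hu'⟩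
    rw [mul_smul, ← hu]
    exact funext hw

variable {ι : Type*} [Fintype ι]

lemma ev_dotProduct (t : ℝ) (v w : ι → Nash) :
    ev t (v ⬝ᵥ w) = (fun i => ev t (v i)) ⬝ᵥ fun i => ev t (w i) := by
  simp [dotProduct]

/-- Every nonzero vector of Nash functions can be normalized. -/
lemma exists_normalized {v : ι → Nash} (hv : v ≠ 0) :
    ∃ (c : Nash) (d : Nash) (w : ι → Nash), c ≠ 0 ∧ c • w = d • v ∧ w ⬝ᵥ w = 1 := by
  obtain ⟨c, u, hc, hu, hu'⟩ := exists_primitive hv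
  obtain ⟨g, hg⟩ := exists_sq_mul_eq_one (f := u ⬝ᵥ u) fun t => by
    rw [ev_dotProduct]
    obtain ⟨i, hi⟩ := hu' t
    exact Finset.sum_pos' (fun j _ => mul_self_nonneg _) ⟨i, Finset.mem_univ i,
      mul_self_pos.2 hi⟩
  refine ⟨c, g, g • u, hc, ?_, ?_⟩
  · rw [hu, smul_comm]
  · rw [smul_dotProduct, dotProduct_smul, ← hg]
    simp only [smul_eq_mul]
    ring

variable [DecidableEq ι]

/-- A vector in a subspace stable under a matrix with split characteristic polynomial yields an
eigenvector in that subspace. -/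
lemma exists_eigenvector {κ : Type*} {H : Matrix ι ι Nash} {lam : κ → Nash}
    {W : Submodule Nash (ι → Nash)} (hW : ∀ w ∈ W, H.mulVec w ∈ W) (s : Finset κ)
    {w : ι → Nash} (hwW : w ∈ W) (hw : w ≠ 0)
    (h : (aeval H (∏ k ∈ s, (X - C (lam k)))).mulVec w = 0) :
    ∃ μ : Nash, ∃ v ∈ W, v ≠ 0 ∧ H.mulVec v = μ • v := by
  classical
  induction s using Finset.induction_on generalizing w with
  | empty => exact absurd (by simpa using h) hw
  | insert a s ha ih =>
    have hfac : (aeval H (X - C (lam a))).mulVec w = H.mulVec w - lam a • w := by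
      rw [map_sub, aeval_X, aeval_C, Matrix.sub_mulVec, Algebra.algebraMap_eq_smul_one,
        Matrix.smul_mulVec, Matrix.one_mulVec]
    -- Either `w` is already an eigenvector, or `(H - lam a) w` is a nonzero vector of `W` killed by
    -- the remaining factors.
    by_cases h0 : H.mulVec w - lam a • w = 0
    · exact ⟨lam a, w, hwW, hw, sub_eq_zero.1 h0⟩
    · refine ih (W.sub_mem (hW w hwW) (W.smul_mem _ hwW)) h0 ?_
      rw [Finset.prod_insert ha, mul_comm] at h
      rw [← hfac, Matrix.mulVec_mulVec, ← map_mul]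
      exact h

/-- Spectral theorem over the Nash functions, for matrices with split characteristic polynomial. -/
lemma exists_orthonormal_eigenvectors {κ : Type*} [Fintype κ] {H : Matrix ι ι Nash}
    (hH : H.IsSymm) {lam : κ → Nash} (hchar : H.charpoly = ∏ k, (X - C (lam k))) (j : ℕ)
    (hj : j ≤ Fintype.card ι) :
    ∃ (φ : Fin j → ι → Nash) (μ : Fin j → Nash),
      (∀ a b, φ a ⬝ᵥ φ b = if a = b then 1 else 0) ∧ ∀ a, H.mulVec (φ a) = μ a • φ a := by
  induction j with
  | zero => exact ⟨Fin.elim0, Fin.elim0, fun a => a.elim0, fun a => a.elim0⟩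
  | succ j ih =>
    obtain ⟨φ, μ, hφ, hμ⟩ := ih (by lia)
    let W : Submodule Nash (ι → Nash) :=
      { carrier := {w | ∀ a, φ a ⬝ᵥ w = 0}
        add_mem' := fun {v w} hv hw a => by rw [dotProduct_add, hv a, hw a, add_zero]
        zero_mem' := fun a => dotProduct_zero _
        smul_mem' := fun c w hw a => by rw [dotProduct_smul, hw a, smul_zero] }
    have hW : ∀ w ∈ W, H.mulVec w ∈ W := by
      intro w hw a
      rw [Matrix.dotProduct_mulVec, ← Matrix.mulVec_transpose, hH, hμ, smul_dotProduct, hw a,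
        smul_zero]
    -- Projections of the standard basis vectors to the orthogonal complement `W`. If all vanished,
    -- summing the squared entries of `φ` in two ways would give `card ι = j`.
    let e : ι → ι → Nash := fun i => Pi.single i 1 - ∑ a, φ a i • φ a
    have heW : ∀ i, e i ∈ W := by
      intro i a
      simp [e, dotProduct_sub, dotProduct_sum, hφ]
    obtain ⟨i, hi⟩ : ∃ i, e i ≠ 0 := by
      by_contra! h
      have h1 : ∀ i, ∑ a, φ a i * φ a i = 1 := by
        intro i
        have := congrFun (h i) i
        simp only [e, Pi.sub_apply, Pi.single_eq_same, Finset.sum_apply, Pi.smul_apply,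
          smul_eq_mul, Pi.zero_apply] at this
        exact (sub_eq_zero.1 this).symm
      have h2 : ∑ i, ∑ a, φ a i * φ a i = (j : Nash) := by
        rw [Finset.sum_comm]
        have : ∀ a, ∑ i, φ a i * φ a i = 1 := fun a => by simpa [dotProduct] using hφ a a
        simp [this]
      simp only [h1, Finset.sum_const, Finset.card_univ, nsmul_eq_mul, mul_one] at h2
      have h3 := congrArg (ev 0) h2
      rw [map_natCast, map_natCast] at h3
      have h4 : Fintype.card ι = j := by exact_mod_cast h3
      lia
    -- By Cayley–Hamilton the full product of the `H - lam k` kills every vector.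
    obtain ⟨ν, v, hvW, hv, hHv⟩ := exists_eigenvector (lam := lam) hW Finset.univ (heW i) hi (by
      rw [← hchar, Matrix.aeval_self_charpoly, Matrix.zero_mulVec])
    obtain ⟨c, d, w, hc, hcw, hw⟩ := exists_normalized hv
    have hwW : ∀ a, φ a ⬝ᵥ w = 0 := by
      intro a
      have : c * (φ a ⬝ᵥ w) = 0 := by
        rw [← smul_eq_mul, ← dotProduct_smul, hcw, dotProduct_smul, hvW a, smul_zero]
      exact (mul_eq_zero.1 this).resolve_left hc
    have hHw : H.mulVec w = ν • w := by
      have : c • H.mulVec w = c • ν • w := by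
        rw [← Matrix.mulVec_smul, hcw, Matrix.mulVec_smul, hHv, smul_comm c, hcw, smul_comm d]
      exact smul_right_injective _ hc this
    refine ⟨Fin.snoc (α := fun _ => ι → Nash) φ w, Fin.snoc (α := fun _ => Nash) μ ν,
      fun a b => ?_, fun a => ?_⟩
    · refine Fin.lastCases ?_ (fun a => ?_) a <;> refine Fin.lastCases ?_ (fun b => ?_) b
      · simpa using hw
      · simpa [dotProduct_comm w, (Fin.castSucc_lt_last b).ne'] using hwW b
      · simpa [(Fin.castSucc_lt_last a).ne] using hwW a
      · simpa using hφ a b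
    · refine Fin.lastCases ?_ (fun a => ?_) a
      · simpa using hHw
      · simpa using hμ a

end Vectors
end Nash

/-! ### Nash eigenvalues and eigenvectors of a symmetric pencil -/

section Pencil

lemma pencil_isSymm {ι : Type*} {A B : Matrix ι ι ℝ} (hA : A.IsSymm) (hB : B.IsSymm) (t : ℝ) :
    (pencil A B t).IsSymm :=
  hA.add (hB.smul t)

/-- The pencil as a matrix over the polynomial ring. -/
noncomputable def polyPencil {ι : Type*} (A B : Matrix ι ι ℝ) : Matrix ι ι ℝ[X] :=
  A.map C + (X : ℝ[X]) • B.map C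

lemma polyPencil_map_eval {ι : Type*} (A B : Matrix ι ι ℝ) (t : ℝ) :
    (polyPencil A B).map (evalRingHom t) = pencil A B t := by
  ext i j
  simp [polyPencil, pencil]
  ring

variable {ι : Type*} [Fintype ι] [DecidableEq ι]

lemma charpoly_pencil (A B : Matrix ι ι ℝ) (t : ℝ) :
    (pencil A B t).charpoly = (polyPencil A B).charpoly.map (evalRingHom t) := by
  rw [← polyPencil_map_eval, Matrix.charpoly_map]

/-- The eigenvalues of a symmetric pencil are Nash functions. -/
lemma exists_nash_eigenvalues {A B : Matrix ι ι ℝ} (hA : A.IsSymm) (hB : B.IsSymm) :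
    ∃ lam : Fin (Fintype.card ι) → Nash,
      ∀ t, (pencil A B t).charpoly = rootPoly fun k => Nash.ev t (lam k) := by
  have hcoe : ∀ i t, ((pencil A B t).charpoly).coeff i = ((polyPencil A B).charpoly.coeff i).eval t :=
    fun i t => by rw [charpoly_pencil, coeff_map]; rfl
  have heval : ∀ x t, ((pencil A B t).charpoly).eval x =
      ((polyPencil A B).charpoly.eval (C x)).eval t := fun x t => by
    rw [charpoly_pencil, eval_map, ← coe_evalRingHom t, ← eval₂_at_apply]
    simp
  have han : ∀ p : ℝ[X], AnalyticOnNhd ℝ (fun t => p.eval t) Set.univ :=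
    fun p => AnalyticOnNhd.eval_polynomial p
  obtain ⟨lam, hlam, h⟩ := exists_analyticOnNhd_roots (n := Fintype.card ι)
    (P := fun t => (pencil A B t).charpoly) (fun s => by
      refine ⟨fun i => ?_, Eventually.of_forall fun t => ?_⟩
      · simp only [hcoe]
        exact han _ s (Set.mem_univ s)
      · refine exists_rootPoly_eq (Matrix.charpoly_monic _) (Matrix.charpoly_natDegree_eq_dim _) ?_
        exact Matrix.IsHermitian.splits_charpoly (pencil_isSymm hA hB t))
    (fun x => by simpa only [heval] using han _)
  -- Each eigenvalue is a root of the monic characteristic polynomial over `ℝ[X]`, as is checked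
  -- pointwise in `t`.
  have halg : ∀ k, IsAlgebraic ℝ[X] (⟨lam k, hlam k⟩ : analyticFunctions) := by
    intro k
    refine ⟨(polyPencil A B).charpoly, (Matrix.charpoly_monic _).ne_zero, ?_⟩
    refine Subtype.ext (funext fun t => ?_)
    let e : analyticFunctions →+* ℝ :=
      (Pi.evalRingHom (fun _ : ℝ => ℝ) t).comp analyticFunctions.subtype
    change e (aeval _ _) = 0
    rw [aeval_def, hom_eval₂]
    have h1 : e.comp (algebraMap ℝ[X] analyticFunctions) = evalRingHom t := rfl
    rw [h1, ← eval_map, ← charpoly_pencil, h, isRoot_rootPoly_iff]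
    exact ⟨k, rfl⟩
  exact ⟨fun k => Nash.ofAlgebraic _ (halg k), h⟩

/-- **Rellich's theorem** for symmetric pencils, with eigenvalues and eigenvectors which are Nash
functions. -/
theorem exists_nash_eigenbasis {A B : Matrix ι ι ℝ} (hA : A.IsSymm) (hB : B.IsSymm) :
    ∃ (μ : ι → Nash) (φ : ι → ι → Nash),
      (∀ a b, φ a ⬝ᵥ φ b = if a = b then 1 else 0) ∧
      ∀ a t, (pencil A B t).mulVec (fun i => Nash.ev t (φ a i)) =
        Nash.ev t (μ a) • fun i => Nash.ev t (φ a i) := by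
  obtain ⟨lam, hlam⟩ := exists_nash_eigenvalues hA hB
  let H : Matrix ι ι Nash := (polyPencil A B).map (algebraMap ℝ[X] Nash)
  have hev : ∀ t, H.map (Nash.ev t) = pencil A B t := fun t => by
    rw [← polyPencil_map_eval]
    ext i j
    simp [H]
  have hH : H.IsSymm := by
    ext i j
    refine Nash.ext_ev fun t => ?_
    have := congrFun (congrFun (pencil_isSymm hA hB t) i) j
    rw [← hev] at this
    exact this
  have hchar : H.charpoly = ∏ k, (X - C (lam k)) := by
    ext i
    refine Nash.ext_ev fun t => ?_
    rw [← coeff_map, ← coeff_map, ← Matrix.charpoly_map, hev, hlam, rootPoly, Polynomial.map_prod]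
    simp
  obtain ⟨φ, μ, hφ, hμ⟩ := Nash.exists_orthonormal_eigenvectors hH hchar _ le_rfl
  let σ := Fintype.equivFin ι
  refine ⟨fun a => μ (σ a), fun a => φ (σ a), fun a b => by simp [hφ], fun a t => ?_⟩
  have h := congrArg (fun v => fun i => Nash.ev t (v i)) (hμ (σ a))
  rw [← hev]
  ext i
  have h1 := congrFun h i
  simp only [Matrix.mulVec, dotProduct, map_sum, map_mul, Pi.smul_apply, smul_eq_mul] at h1
  simpa [Matrix.mulVec, dotProduct] using h1

end Pencil

/-! ### Eigenbases of a fixed matrix and the good/bad dichotomy -/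

section Eigenbasis

variable {ι : Type*} [Fintype ι] [DecidableEq ι]

/-- `u` is an orthonormal eigenbasis of `M` with eigenvalues `lam`. -/
structure IsEigenbasis (M : Matrix ι ι ℝ) (lam : ι → ℝ) (u : ι → ι → ℝ) : Prop where
  orthonormal : ∀ a b, u a ⬝ᵥ u b = if a = b then 1 else 0
  eigen : ∀ a, M.mulVec (u a) = lam a • u a

namespace IsEigenbasis

variable {M : Matrix ι ι ℝ} {lam : ι → ℝ} {u : ι → ι → ℝ}

lemma sum_dotProduct_smul (h : IsEigenbasis M lam u) (v : ι → ℝ) :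
    ∑ a, (u a ⬝ᵥ v) • u a = v := by
  have h1 : Matrix.of u * (Matrix.of u).transpose = 1 := by
    ext a b
    simpa [Matrix.mul_apply, dotProduct, Matrix.one_apply] using h.orthonormal a b
  have h2 : (Matrix.of u).transpose.mulVec ((Matrix.of u).mulVec v) = v := by
    rw [Matrix.mulVec_mulVec, mul_eq_one_comm.1 h1, Matrix.one_mulVec]
  conv_rhs => rw [← h2]
  ext i
  simp [Matrix.mulVec, dotProduct, mul_comm]

lemma ne_zero (h : IsEigenbasis M lam u) (a : ι) : u a ≠ 0 := by
  intro h0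
  simpa [h0] using h.orthonormal a a

/-- Orthogonality of eigenvectors for different eigenvalues, as a product: applied along the pencil,
it becomes a relation between analytic functions, where one factor must vanish identically. -/
lemma dotProduct_mul_eq (h : IsEigenbasis M lam u) (hM : M.IsSymm) {r : ℝ} {v : ι → ℝ}
    (hv : M.mulVec v = r • v) (a : ι) : (u a ⬝ᵥ v) * (r - lam a) = 0 := by
  have h1 : u a ⬝ᵥ M.mulVec v = M.mulVec (u a) ⬝ᵥ v := by
    rw [Matrix.dotProduct_mulVec, ← Matrix.mulVec_transpose, hM]
  rw [hv, h.eigen, dotProduct_smul, smul_dotProduct, smul_eq_mul, smul_eq_mul] at h1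
  linear_combination h1

lemma hasEigenvector (h : IsEigenbasis M lam u) (a : ι) :
    Module.End.HasEigenvector (Matrix.toLin' M) (lam a) (u a) :=
  ⟨Module.End.mem_eigenspace_iff.2 (by simpa using h.eigen a), h.ne_zero a⟩

/-- An eigenvector for a simple eigenvalue is a multiple of the basis vector. -/
lemma exists_eq_smul (h : IsEigenbasis M lam u) (hM : M.IsSymm) (hlam : Function.Injective lam)
    {r : ℝ} {v : ι → ℝ} (hv : M.mulVec v = r • v) (hv0 : v ≠ 0) :
    ∃ a, lam a = r ∧ ∃ c : ℝ, c ≠ 0 ∧ v = c • u a := by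
  obtain ⟨a, ha⟩ : ∃ a, u a ⬝ᵥ v ≠ 0 := by
    by_contra! h0
    exact hv0 (by rw [← h.sum_dotProduct_smul v]; simp [h0])
  have hr : ∀ b, u b ⬝ᵥ v ≠ 0 → lam b = r := fun b hb =>
    (sub_eq_zero.1 ((mul_eq_zero.1 (h.dotProduct_mul_eq hM hv b)).resolve_left hb)).symm
  refine ⟨a, hr a ha, u a ⬝ᵥ v, ha, ?_⟩
  conv_lhs => rw [← h.sum_dotProduct_smul v]
  refine Finset.sum_eq_single a (fun b _ hba => ?_) (by simp)
  rw [show u b ⬝ᵥ v = 0 from by_contra fun hb => hba (hlam ((hr b hb).trans (hr a ha).symm)),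
    zero_smul]

lemma hasSimpleEigenvalues_iff (h : IsEigenbasis M lam u) (hM : M.IsSymm) :
    HasSimpleEigenvalues M ↔ Function.Injective lam := by
  constructor
  · intro hs a b hab
    by_contra hne
    have h1 := hs (lam a) (Module.End.hasEigenvalue_of_hasEigenvector (h.hasEigenvector a))
    obtain ⟨c, hc⟩ := (finrank_eq_one_iff_of_nonzero'
      (⟨u a, (h.hasEigenvector a).1⟩ : Module.End.eigenspace (Matrix.toLin' M) (lam a))
      (by simpa using h.ne_zero a)).1 h1 ⟨u b, hab ▸ (h.hasEigenvector b).1⟩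
    have hc' : c • u a = u b := congrArg Subtype.val hc
    have h2 := h.orthonormal a b
    rw [if_neg hne, ← hc', dotProduct_smul, h.orthonormal, if_pos rfl, smul_eq_mul, mul_one] at h2
    exact h.ne_zero b (by rw [← hc', h2, zero_smul])
  · intro hinj r hr
    obtain ⟨v, hv⟩ := hr.exists_hasEigenvector
    have hmem : ∀ w ∈ Module.End.eigenspace (Matrix.toLin' M) r, M.mulVec w = r • w := fun w hw => by
      simpa using Module.End.mem_eigenspace_iff.1 hw
    obtain ⟨a, rfl, c, hc, -⟩ := h.exists_eq_smul hM hinj (hmem v hv.1) hv.2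
    refine (finrank_eq_one_iff_of_nonzero'
      (⟨u a, (h.hasEigenvector a).1⟩ : Module.End.eigenspace (Matrix.toLin' M) (lam a))
      (by simpa using h.ne_zero a)).2 fun w => ?_
    by_cases hw : w = 0
    · exact ⟨0, by rw [hw, zero_smul]⟩
    · obtain ⟨b, hb, d, -, hd⟩ := h.exists_eq_smul hM hinj (hmem w w.2) (by simpa using hw)
      exact ⟨d, Subtype.ext (by rw [hd, hinj hb]; rfl)⟩

lemma hasNonvanishingEigenvectors (h : IsEigenbasis M lam u) (hM : M.IsSymm)
    (hinj : Function.Injective lam) (hu : ∀ a i, u a i ≠ 0) : HasNonvanishingEigenvectors M := by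
  intro r v hv i
  obtain ⟨a, -, c, hc, rfl⟩ := h.exists_eq_smul hM hinj
    (by simpa using Module.End.mem_eigenspace_iff.1 hv.1) hv.2
  exact mul_ne_zero hc (hu a i)

end IsEigenbasis

/-- A symmetric pencil is either good or bad, and not both. -/
theorem xor_isGoodPair_isBadPair {A B : Matrix ι ι ℝ} (hA : A.IsSymm) (hB : B.IsSymm) :
    Xor (IsGoodPair A B) (IsBadPair A B) := by
  obtain ⟨μ, φ, hφ, hμ⟩ := exists_nash_eigenbasis hA hB
  have hbasis : ∀ t, IsEigenbasis (pencil A B t) (fun a => Nash.ev t (μ a))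
      fun a i => Nash.ev t (φ a i) := fun t =>
    ⟨fun a b => by rw [← Nash.ev_dotProduct, hφ]; split_ifs <;> simp, fun a => hμ a t⟩
  have hsymm := pencil_isSymm hA hB
  -- Conditions on functions, not on values: if they hold, the exceptional `t` are zeros of finitely
  -- many nonzero Nash functions; if they fail, the same failure occurs at every `t`.
  by_cases hgood : Function.Injective μ ∧ ∀ a i, φ a i ≠ 0
  · have hfin : IsGoodPair A B := by
      have h1 : (⋃ p : {p : ι × ι // p.1 ≠ p.2},
          {t : ℝ | Nash.ev t (μ p.1.1 - μ p.1.2) = 0}).Finite :=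
        Set.finite_iUnion fun p =>
          Nash.finite_zeros (sub_ne_zero.2 fun h => p.2 (hgood.1 h))
      have h2 : (⋃ p : ι × ι, {t : ℝ | Nash.ev t (φ p.1 p.2) = 0}).Finite :=
        Set.finite_iUnion fun p => Nash.finite_zeros (hgood.2 p.1 p.2)
      refine (h1.union h2).subset fun t ht => ?_
      by_contra hnot
      simp only [Set.mem_union, Set.mem_iUnion, not_or, not_exists, Set.mem_ofPred_eq] at hnot
      have hinj : Function.Injective fun a => Nash.ev t (μ a) := by
        intro a b hab
        by_contra hne
        exact hnot.1 ⟨(a, b), hne⟩ (by simpa [sub_eq_zero] using hab)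
      exact ht ⟨((hbasis t).hasSimpleEigenvalues_iff (hsymm t)).2 hinj,
        (hbasis t).hasNonvanishingEigenvectors (hsymm t) hinj fun a i => hnot.2 (a, i)⟩
    refine Or.inl ⟨hfin, fun hbad => ?_⟩
    refine Set.infinite_univ (α := ℝ) (hfin.subset fun t _ => ?_)
    rintro ⟨h1, h2⟩
    exact (hbad t).elim (fun h => h h1) fun h => h h2
  · have hbad : IsBadPair A B := by
      intro t
      rw [not_and_or] at hgood
      rcases hgood with h | h
      · left
        rw [(hbasis t).hasSimpleEigenvalues_iff (hsymm t)]
        exact fun hinj => h fun a b hab => hinj (by simp [hab])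
      · right
        push Not at h
        obtain ⟨a, i, hai⟩ := h
        exact fun hnv => hnv _ _ ((hbasis t).hasEigenvector a) i (by simp [hai])
    refine Or.inr ⟨hbad, fun hfin => ?_⟩
    refine Set.infinite_univ (α := ℝ) (hfin.subset fun t _ => ?_)
    rintro ⟨h1, h2⟩
    exact (hbad t).elim (fun h => h h1) fun h => h h2

end Eigenbasis

/-! ### Comparison of analytic eigenbases -/

section AnalyticEigenbasis

variable {n : ℕ} {A B : Matrix (Fin n) (Fin n) ℝ}

lemma IsAnalyticEigenbasis.isEigenbasis {lam : Fin n → ℝ → ℝ}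
    {phi : Fin n → ℝ → EuclideanSpace ℝ (Fin n)} (h : IsAnalyticEigenbasis A B lam phi) (t : ℝ) :
    IsEigenbasis (pencil A B t) (fun k => lam k t) fun k i => phi k t i := by
  refine ⟨fun a b => ?_, fun a => ?_⟩
  · have := orthonormal_iff_ite.1 (h.orthonormal t) a b
    rw [← this]
    simp [PiLp.inner_apply, dotProduct, mul_comm]
  · have := congrArg (fun v : EuclideanSpace ℝ (Fin n) => v.ofLp) (h.eigen a t)
    simpa using! this

lemma IsAnalyticEigenbasis.analytic_apply {lam : Fin n → ℝ → ℝ}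
    {phi : Fin n → ℝ → EuclideanSpace ℝ (Fin n)} (h : IsAnalyticEigenbasis A B lam phi)
    (k i : Fin n) : AnalyticOnNhd ℝ (fun t => phi k t i) Set.univ := fun t ht =>
  ((EuclideanSpace.proj i : EuclideanSpace ℝ (Fin n) →L[ℝ] ℝ).analyticAt _).comp
    (h.analytic_phi k t ht)

/-- There is an analytic eigenbasis consisting of Nash functions. -/
lemma exists_isAnalyticEigenbasis_nash (hA : A.IsSymm) (hB : B.IsSymm) :
    ∃ (μ : Fin n → Nash) (φ : Fin n → Fin n → Nash),
      IsAnalyticEigenbasis A B (fun k t => Nash.ev t (μ k))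
        fun k t => WithLp.toLp 2 fun i => Nash.ev t (φ k i) := by
  obtain ⟨μ, φ, hφ, hμ⟩ := exists_nash_eigenbasis hA hB
  refine ⟨μ, φ, fun k => (μ k).analytic, fun k t ht => ?_, fun t => ?_, fun k t => ?_⟩
  · refine ((PiLp.continuousLinearEquiv 2 ℝ fun _ : Fin n => ℝ).symm.toContinuousLinearMap.analyticAt
      _).comp (analyticAt_pi_iff.2 fun i => (φ k i).analytic t ht)
  · rw [orthonormal_iff_ite]
    intro a b
    have h := congrArg (Nash.ev t) (hφ b a)
    rw [Nash.ev_dotProduct] at h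
    rw [EuclideanSpace.inner_toLp_toLp]
    simp only [star_trivial]
    rw [h]
    simp only [eq_comm (a := b)]
    split_ifs <;> simp
  · have := congrArg (WithLp.toLp 2) (hμ k t)
    simpa using! this

/-- Every analytic eigenbasis has the same eigenvalues as a given one, and the eigenvectors for
simple eigenvalues have the same zeros. -/
lemma IsAnalyticEigenbasis.exists_eq {lam mu : Fin n → ℝ → ℝ}
    {phi psi : Fin n → ℝ → EuclideanSpace ℝ (Fin n)} (hA : A.IsSymm) (hB : B.IsSymm)
    (h : IsAnalyticEigenbasis A B lam phi) (h' : IsAnalyticEigenbasis A B mu psi) (k : Fin n) :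
    ∃ j, lam k = mu j ∧ ((∀ k' ≠ k, ∃ t, lam k t - lam k' t ≠ 0) →
      ∀ t i, phi k t i = 0 ↔ psi j t i = 0) := by
  let d : Fin n → Fin n → ℝ → ℝ := fun k j t => (fun i => psi j t i) ⬝ᵥ fun i => phi k t i
  have hd : ∀ k j, AnalyticOnNhd ℝ (d k j) Set.univ := fun k j t ht =>
    Finset.analyticAt_fun_sum _ fun i _ =>
      (h'.analytic_apply j i t ht).mul (h.analytic_apply k i t ht)
  have hor : ∀ k j, (∀ t, d k j t = 0) ∨ lam k = mu j := by
    intro k j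
    refine (AnalyticOnNhd.eq_zero_or_eq_zero_of_mul_eq_zero (hd k j)
      ((h.analytic_lam k).sub (h'.analytic_lam j)) (fun t _ => ?_) isPreconnected_univ).imp
      (fun h0 t => h0 t (Set.mem_univ t)) fun h0 => funext fun t => ?_
    · exact (h'.isEigenbasis t).dotProduct_mul_eq (pencil_isSymm hA hB t)
        ((h.isEigenbasis t).eigen k) j
    · exact sub_eq_zero.1 (h0 t (Set.mem_univ t))
  -- Otherwise `phi k 0` would be orthogonal to a whole basis.
  obtain ⟨j, hj⟩ : ∃ j, ∃ t, d k j t ≠ 0 := by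
    by_contra! h0
    refine (h.isEigenbasis 0).ne_zero k ?_
    rw [← (h'.isEigenbasis 0).sum_dotProduct_smul fun i => phi k 0 i]
    refine Finset.sum_eq_zero fun j _ => ?_
    rw [show ((fun i => psi j 0 i) ⬝ᵥ fun i => phi k 0 i) = 0 from h0 j 0, zero_smul]
  have hkj : lam k = mu j := (hor k j).resolve_left fun h0 => hj.elim fun t ht => ht (h0 t)
  refine ⟨j, hkj, fun hsimple t i => ?_⟩
  -- By analyticity this orthogonality holds at every `t`, also where eigenvalues cross. Hence `psi
  -- j t` is a multiple of `phi k t`, with nonzero factor since `psi j t ≠ 0`.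
  have hzero : ∀ k' ≠ k, d k' j t = 0 := by
    intro k' hk'
    refine ((hor k' j).resolve_right fun heq => ?_) t
    obtain ⟨s, hs⟩ := hsimple k' hk'
    exact hs (by rw [hkj, heq, sub_self])
  have hpsi : (fun i => psi j t i) = d k j t • fun i => phi k t i := by
    conv_lhs => rw [← (h.isEigenbasis t).sum_dotProduct_smul fun i => psi j t i]
    refine (Finset.sum_eq_single k (fun k' _ hk' => ?_) (by simp)).trans ?_
    · rw [dotProduct_comm, show ((fun i => psi j t i) ⬝ᵥ fun i => phi k' t i) = 0 from hzero k' hk',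
        zero_smul]
    · rw [dotProduct_comm]
  have hne : d k j t ≠ 0 := by
    intro h0
    rw [h0, zero_smul] at hpsi
    exact (h'.isEigenbasis t).ne_zero j hpsi
  have hi := congrFun hpsi i
  simp only [Pi.smul_apply, smul_eq_mul] at hi
  rw [hi]
  simp [hne]

end AnalyticEigenbasis

lemma Nash.finite_of_exists_ne {f : Nash} (h : ∃ t, Nash.ev t f ≠ 0) :
    {t : ℝ | Nash.ev t f = 0}.Finite :=
  Nash.finite_zeros fun h0 => h.elim fun t ht => ht (by rw [h0, map_zero])

end AndersonSpectral

theorem proposition2p2 :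
    (∀ (n : ℕ) (A B : Matrix (Fin n) (Fin n) ℝ), A.IsSymm → B.IsSymm →
      -- an analytic orthonormal eigenbasis on the whole line for which both dichotomies hold
      (∃ (lam : Fin n → ℝ → ℝ) (phi : Fin n → ℝ → EuclideanSpace ℝ (Fin n)),
        AndersonSpectral.IsAnalyticEigenbasis A B lam phi ∧
        (∀ k k' : Fin n, k ≠ k' → (∃ t, lam k t - lam k' t ≠ 0) →
          {t : ℝ | lam k t - lam k' t = 0}.Finite) ∧
        (∀ k i : Fin n, (∃ t, phi k t i ≠ 0) → {t : ℝ | phi k t i = 0}.Finite)) ∧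
      -- for an arbitrary analytic orthonormal eigenbasis: all gaps, and all entries of those
      -- eigenvectors whose eigenvalue does not coincide identically with another one
      (∀ (lam : Fin n → ℝ → ℝ) (phi : Fin n → ℝ → EuclideanSpace ℝ (Fin n)),
        AndersonSpectral.IsAnalyticEigenbasis A B lam phi →
        (∀ k k' : Fin n, k ≠ k' → (∃ t, lam k t - lam k' t ≠ 0) →
          {t : ℝ | lam k t - lam k' t = 0}.Finite) ∧
        (∀ k : Fin n, (∀ k' : Fin n, k' ≠ k → ∃ t, lam k t - lam k' t ≠ 0) →
          ∀ i : Fin n, (∃ t, phi k t i ≠ 0) → {t : ℝ | phi k t i = 0}.Finite)) ∧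
      Xor (AndersonSpectral.IsGoodPair A B) (AndersonSpectral.IsBadPair A B)) ∧
    (∀ (V : Type*) [Fintype V] [DecidableEq V] (G : SimpleGraph V) [DecidableRel G.Adj]
      (w : V → ℝ),
      Xor (AndersonSpectral.IsGoodPotential G w) (AndersonSpectral.IsBadPotential G w)) := by
  refine ⟨fun n A B hA hB => ?_, fun V _ _ G _ w =>
    AndersonSpectral.xor_isGoodPair_isBadPair (G.isSymm_lapMatrix ℝ) (Matrix.isSymm_diagonal w)⟩
  obtain ⟨μ, φ, hb⟩ := AndersonSpectral.exists_isAnalyticEigenbasis_nash hA hB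
  have hgap : ∀ k k' : Fin n,
      (∃ t, AndersonSpectral.Nash.ev t (μ k) - AndersonSpectral.Nash.ev t (μ k') ≠ 0) →
      {t : ℝ | AndersonSpectral.Nash.ev t (μ k) - AndersonSpectral.Nash.ev t (μ k') = 0}.Finite := by
    intro k k' h
    simp only [← map_sub] at h ⊢
    exact AndersonSpectral.Nash.finite_of_exists_ne h
  have hentry : ∀ k i : Fin n, (∃ t, AndersonSpectral.Nash.ev t (φ k i) ≠ 0) →
      {t : ℝ | AndersonSpectral.Nash.ev t (φ k i) = 0}.Finite := fun k i =>
    AndersonSpectral.Nash.finite_of_exists_ne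
  refine ⟨⟨_, _, hb, fun k k' _ h => hgap k k' h, fun k i h => hentry k i h⟩,
    fun lam phi h => ⟨fun k k' _ hne => ?_, fun k hsimple i hne => ?_⟩,
    AndersonSpectral.xor_isGoodPair_isBadPair hA hB⟩
  -- The gap is a difference of two Nash eigenvalues; `j = j'` need not be excluded, since `hgap`
  -- does not ask for distinct indices.
  · obtain ⟨j, hj, -⟩ := h.exists_eq hA hB hb k
    obtain ⟨j', hj', -⟩ := h.exists_eq hA hB hb k'
    rw [hj, hj'] at hne ⊢
    exact hgap j j' hne
  · obtain ⟨j, -, hj⟩ := h.exists_eq hA hB hb k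
    have hj := hj hsimple
    simp only [hj, ne_eq] at hne ⊢
    exact hentry j i hne
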